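/- Let $H$ be a complex Hilbert space, and let $T$ be an operator in $H$ whose spectrum is $\{t_k\}_{k\ge1}\subset\mathbb R$, where $T\phi_k=t_k\phi_k$ and $\{\phi_k\}_{k\ge1}$ is an orthonormal basis of $H$. Let $\alpha\in(0,\infty)\setminus\{1\}$ and $\kappa>0$, and suppose $$t_{k+1}-t_k\ \ge\ \kappa\,k^{\alpha-1}\qquad(k\ge 1).$$ Let $B$ be a closed operator with $\operatorname{dom}B\supseteq\operatorname{dom}T$ and $\|B\phi_k\|=c_k k^{\alpha-1}$, where $c_k\to0$. Put $L=T+B$ (on $\operatorname{dom}T$), $c_\infty=\sup_k|c_k|$, $v=2^{1/|\alpha-1|}$, $D=1024\cdot4^{\alpha}(\alpha^2+1/\alpha)$, and let $V_J$ be the set of the positive integers in $[v^J,v^{J+1})$, $J=0,1,2,\dots$. Then $\operatorname{Sp}L$ is discrete (it has no accumulation point in $\mathbb C$ and consists of eigenvalues of finite algebraic multiplicity) and eventually simple (all but finitely many of its points have algebraic multiplicity $1$). Furthermore, every sufficiently large integer $N$ satisfies $$\kappa^2v^{\alpha N}>D\,c_\infty^2\qquad\text{and}\qquad D\,c_j^2\le\kappa^2\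 \text{ for all } j\in V_J,\ J\ge N/2. \tag{$*$}$$ Let $N\ge0$ be any integer satisfying $(*)$, let $\ell=\max\bigcup_{J\le N}V_J$, and let $Y>0$ be any number with $Y^2\ge4c_\infty^2\sum_{k=1}^{\ell}k^{2(\alpha-1)}$. Put $$\Pi_0=\{a+ib:\ \min(0,t_1)-Y\le a\le t_\ell+\tfrac\kappa2\ell^{\alpha-1},\ |b|\le Y\},$$ $$\Pi_k=\{a+ib:\ t_k-\tfrac\kappa2\max(k-1,1)^{\alpha-1}\le a\le t_k+\tfrac\kappa2k^{\alpha-1},\ |b|\le\tfrac\kappa2k^{\alpha-1}\}\qquad(k\ge1),$$ and $\Lambda_k=\partial\Pi_k$ for $k\ge0$, oriented counterclockwise. Then $$\operatorname{Sp}L\subset\Pi_0\cup\bigcup_{j>\ell}\Pi_j .$$ Moreover, $\Lambda_0$ and the $\Lambda_j$ with $j>\ell$ do not meet $\operatorname{Sp}L$, and no $\Lambda_j$ with $j\ge1$ meets $\operatorname{Sp}T$. With $$U_\ell=\frac1{2\pi i}\int_{\Lambda_0}(z-L)^{-1}dz,\quad Q_j=\frac1{2\pi i}\int_{\Lambda_j}(z-L)^{-1}dz\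 (j>\ell),\quad Q_j^0=\frac1{2\pi i}\int_{\Lambda_j}(z-T)^{-1}dz\ (j\ge1),$$ where $\dim$ denotes the dimension of the range, $$\dim U_\ell=\sum_{j=1}^{\ell}\dim Q_j^0,\qquad \dim Q_j=\dim Q_j^0=1\quad\text{for all } j>\ell .$$ -/

import Mathlib

open Filter Topology

noncomputable section

namespace PerturbedOperator

variable {H : Type*} [NormedAddCommGroup H] [InnerProductSpace ℂ H]

/-- `R` is a bounded, everywhere defined, two-sided inverse of `z - A : dom A → H`. -/
def IsResolventAt (A : H →ₗ.[ℂ] H) (z : ℂ) (R : H →L[ℂ] H) : Prop :=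
  (∀ y : H, ∃ h : R y ∈ A.domain, z • R y - A ⟨R y, h⟩ = y) ∧
    ∀ x : A.domain, R (z • (x : H) - A x) = x

/-- A bounded inverse of `z - A` is unique. -/
theorem IsResolventAt.unique {A : H →ₗ.[ℂ] H} {z : ℂ} {R S : H →L[ℂ] H}
    (hR : IsResolventAt A z R) (hS : IsResolventAt A z S) : R = S := by
  ext y
  obtain ⟨h, hy⟩ := hS.1 y
  have := hR.2 ⟨S y, h⟩
  rwa [hy] at this

/-- The spectrum of an unbounded operator: all `z` for which `z - A : dom A → H` has no bounded,
everywhere defined inverse. -/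
def opSpectrum (A : H →ₗ.[ℂ] H) : Set ℂ := {z | ¬ ∃ R : H →L[ℂ] H, IsResolventAt A z R}

open Classical in
/-- The resolvent `R(z) = (z - A)⁻¹` (with the value `0` on the spectrum). -/
def opResolvent (A : H →ₗ.[ℂ] H) (z : ℂ) : H →L[ℂ] H :=
  if h : ∃ R : H →L[ℂ] H, IsResolventAt A z R then h.choose else 0

/-- `w` is an eigenvalue of the unbounded operator `A`. -/
def IsEigenvalue (A : H →ₗ.[ℂ] H) (w : ℂ) : Prop :=
  ∃ x : A.domain, (x : H) ≠ 0 ∧ A x = w • (x : H)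

/-- `w` is isolated from the other points of the spectrum of `A`, and the Riesz projection
`(2πi)⁻¹ ∮_{|z - w| = r} (z - A)⁻¹ dz` of `A` at `w` has rank `m`, that is, `w` has algebraic
multiplicity `m`. -/
def HasAlgMultiplicity (A : H →ₗ.[ℂ] H) (w : ℂ) (m : ℕ) : Prop :=
  ∃ r : ℝ, 0 < r ∧ opSpectrum A ∩ Metric.closedBall w r ⊆ {w} ∧
    LinearMap.rank (((2 * Real.pi * Complex.I : ℂ)⁻¹ •
      ∮ z in C(w, r), opResolvent A z : H →L[ℂ] H) : H →ₗ[ℂ] H) = (m : Cardinal)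

/-- The spectrum of `A` is discrete: it has no accumulation point in `ℂ`, and it consists of
eigenvalues of finite algebraic multiplicity. -/
def HasDiscreteSpectrum (A : H →ₗ.[ℂ] H) : Prop :=
  (∀ z : ℂ, ∃ r : ℝ, 0 < r ∧ opSpectrum A ∩ Metric.closedBall z r ⊆ {z}) ∧
    ∀ w ∈ opSpectrum A, IsEigenvalue A w ∧ ∃ m : ℕ, HasAlgMultiplicity A w m

/-- All but finitely many points of the spectrum of `A` have algebraic multiplicity one. -/
def HasEventuallySimpleSpectrum (A : H →ₗ.[ℂ] H) : Prop :=
  {w ∈ opSpectrum A | ¬ HasAlgMultiplicity A w 1}.Finite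

/-- The closed rectangle `{x + iy : a₁ ≤ x ≤ a₂, |y| ≤ b}`. -/
def box (a₁ a₂ b : ℝ) : Set ℂ := {z | a₁ ≤ z.re ∧ z.re ≤ a₂ ∧ |z.im| ≤ b}

/-- `(2πi)⁻¹ ∫ (z - A)⁻¹ dz`, taken counterclockwise along the boundary of `box a₁ a₂ b`. -/
def boxProjection (A : H →ₗ.[ℂ] H) (a₁ a₂ b : ℝ) : H →L[ℂ] H :=
  (2 * Real.pi * Complex.I : ℂ)⁻¹ •
    ((∫ x in a₁..a₂, opResolvent A ((x : ℂ) - (b : ℂ) * Complex.I))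
      - (∫ x in a₁..a₂, opResolvent A ((x : ℂ) + (b : ℂ) * Complex.I))
      + Complex.I • (∫ y in (-b)..b, opResolvent A ((a₂ : ℂ) + (y : ℂ) * Complex.I))
      - Complex.I • (∫ y in (-b)..b, opResolvent A ((a₁ : ℂ) + (y : ℂ) * Complex.I)))

/-- The dimension of (the range of) a bounded operator. -/
def opDim (Q : H →L[ℂ] H) : Cardinal := LinearMap.rank (Q : H →ₗ[ℂ] H)

/-- `v = 2 ^ (1 / |α - 1|)`. -/
def ratio (α : ℝ) : ℝ := 2 ^ (1 / |α - 1|)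

/-- `V_J`, the set of the positive integers in `[v ^ J, v ^ (J + 1))`. -/
def block (α : ℝ) (J : ℕ) : Set ℕ+ :=
  {k | ratio α ^ J ≤ (k : ℝ) ∧ (k : ℝ) < ratio α ^ (J + 1)}

/-- The constant `D(α) = 1024 · 4 ^ α · (α² + 1/α)`. -/
def threshold (α : ℝ) : ℝ := 1024 * 4 ^ α * (α ^ 2 + 1 / α)

/-- `N` is large enough for the localization:
`κ² v^{αN} > D c_∞²`, where `c_∞ = sup |c_k|`, and `D c_j² ≤ κ²` for all `j ∈ V_J`, `J ≥ N/2`. -/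
def IsLargeEnough (α κ : ℝ) (c : ℕ+ → ℝ) (N : ℕ) : Prop :=
  threshold α * (⨆ k, |c k|) ^ 2 < κ ^ 2 * ratio α ^ (α * (N : ℝ)) ∧
    ∀ J : ℕ, (N : ℝ) / 2 ≤ (J : ℝ) → ∀ j ∈ block α J, threshold α * c j ^ 2 ≤ κ ^ 2

/-- Left end of the box around `t_k`: `t_k - (κ/2) (k-1)^{α-1}` for `k ≥ 2`, and `t_1 - κ/2` for
`k = 1`. -/
def leftEnd (α κ : ℝ) (t : ℕ+ → ℝ) (k : ℕ+) : ℝ :=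
  t k - κ / 2 * (max ((k : ℝ) - 1) 1) ^ (α - 1)

/-- Right end of the box around `t_k`. -/
def rightEnd (α κ : ℝ) (t : ℕ+ → ℝ) (k : ℕ+) : ℝ := t k + κ / 2 * (k : ℝ) ^ (α - 1)

/-- Half the height of the box around `t_k`. -/
def halfHeight (α κ : ℝ) (k : ℕ+) : ℝ := κ / 2 * (k : ℝ) ^ (α - 1)

/-- The box `Π_k` around `t_k`, `k ≥ 1`. -/
def smallBox (α κ : ℝ) (t : ℕ+ → ℝ) (k : ℕ+) : Set ℂ :=
  box (leftEnd α κ t k) (rightEnd α κ t k) (halfHeight α κ k)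

/-- The box `Π_0`, which surrounds `t_1, …, t_ℓ`. -/
def bigBox (α κ : ℝ) (t : ℕ+ → ℝ) (ℓ : ℕ+) (Y : ℝ) : Set ℂ :=
  box (min 0 (t 1) - Y) (rightEnd α κ t ℓ) Y

/-- `(2πi)⁻¹ ∫ (z - A)⁻¹ dz` along the boundary of `Π_k`: this is `Q_k⁰` for `A = T` and `Q_k` for
`A = L`. -/
def smallProjection (A : H →ₗ.[ℂ] H) (α κ : ℝ) (t : ℕ+ → ℝ) (k : ℕ+) : H →L[ℂ] H :=
  boxProjection A (leftEnd α κ t k) (rightEnd α κ t k) (halfHeight α κ k)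

/-- `(2πi)⁻¹ ∫ (z - A)⁻¹ dz` along the boundary of `Π_0`: this is `U_ℓ` for `A = L`. -/
def bigProjection (A : H →ₗ.[ℂ] H) (α κ : ℝ) (t : ℕ+ → ℝ) (ℓ : ℕ+) (Y : ℝ) : H →L[ℂ] H :=
  boxProjection A (min 0 (t 1) - Y) (rightEnd α κ t ℓ) Y

end PerturbedOperator

end

noncomputable section

namespace PerturbedOperator

open Complex MeasureTheory Set

/-! For z off the spectrum of T put K(z) = B (z - T)⁻¹. Expanding in the basis, Cauchy–Schwarz and
Bessel give ‖K(z)‖² ≤ ∑ ‖B φ_k‖² / |z - t_k|², where closedness of B justifies applying B termwise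
(`exists_bounded_comp_resolvent`). The heart of the matter is that this sum is at most 1/2 for every
z outside the open boxes (`sum_le_of_notMem`). Since z - T - sB = (1 - s K(z)) (z - T), such z
belong to the resolvent set of T + sB for all 0 ≤ s ≤ 1. On a contour the resolvent is Lipschitz in
s, and idempotents at distance below 1 have equal rank, so the Riesz projections of T + B and of T
have the same rank (`opDim_boxProjection_add`); that of the diagonal T counts the t_k inside
(`opDim_boxProjection_diagonal`).

For the sum, let z lie to the right of the big box and outside the small ones, with t_m ≤ Re z <
t_(m+1). Adding up gaps gives |z - t_k| ≥ (κ/4) 2^(-α) r k^(α-1), where r = k - m for k > m and r =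
min(m+1-k, k) for k ≤ m. If D c_k² ≤ κ², the k-th term is at most r⁻²/64. By (*), every other k has
k² < v^(N+1) ≤ ℓ + 1; its t_k is at distance at least (κ/4) 2^(-α) (ℓ+1)^α from z, and the first
half of (*) bounds the term by k⁻²/64. If Re z is smaller than the right end of Π_0, then every |z -
t_k| is at least Y, which controls k ≤ ℓ, and the later terms are treated as before.

Discreteness and simplicity follow from Riesz theory: inside a contour with Riesz projection Q of
finite rank, a spectral point is an eigenvalue with an eigenvector in the range of Q
(`exists_eigenvector_of_mem_openBox`), and its own Riesz projection factors through Q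
(`circleProjection_eq_mul`). -/

/-- The open rectangle `{x + iy : a₁ < x < a₂, |y| < b}`. -/
def openBox (a₁ a₂ b : ℝ) : Set ℂ := {z | a₁ < z.re ∧ z.re < a₂ ∧ |z.im| < b}

/-- The integral of `f`, counterclockwise along the boundary of `box a₁ a₂ b`. -/
def boxIntegral {E : Type*} [NormedAddCommGroup E] [NormedSpace ℂ E] (a₁ a₂ b : ℝ) (f : ℂ → E) :
    E :=
  (∫ x in a₁..a₂, f ((x : ℂ) - (b : ℂ) * I)) - (∫ x in a₁..a₂, f ((x : ℂ) + (b : ℂ) * I))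
    + I • (∫ y in (-b)..b, f ((a₂ : ℂ) + (y : ℂ) * I))
    - I • (∫ y in (-b)..b, f ((a₁ : ℂ) + (y : ℂ) * I))

theorem box_eq_reProdIm (a₁ a₂ b : ℝ) : box a₁ a₂ b = Icc a₁ a₂ ×ℂ Icc (-b) b := by
  ext z
  simp [box, mem_reProdIm, abs_le, and_assoc]

theorem openBox_eq_reProdIm (a₁ a₂ b : ℝ) : openBox a₁ a₂ b = Ioo a₁ a₂ ×ℂ Ioo (-b) b := by
  ext z
  simp [openBox, mem_reProdIm, abs_lt, and_assoc]

theorem isClosed_box (a₁ a₂ b : ℝ) : IsClosed (box a₁ a₂ b) := by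
  rw [box_eq_reProdIm]
  exact isClosed_Icc.reProdIm isClosed_Icc

theorem isCompact_box (a₁ a₂ b : ℝ) : IsCompact (box a₁ a₂ b) := by
  rw [box_eq_reProdIm]
  exact isCompact_Icc.reProdIm isCompact_Icc

theorem isOpen_openBox (a₁ a₂ b : ℝ) : IsOpen (openBox a₁ a₂ b) := by
  rw [openBox_eq_reProdIm]
  exact isOpen_Ioo.reProdIm isOpen_Ioo

theorem openBox_subset_box (a₁ a₂ b : ℝ) : openBox a₁ a₂ b ⊆ box a₁ a₂ b :=
  fun _ h => ⟨h.1.le, h.2.1.le, h.2.2.le⟩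

theorem frontier_box (a₁ a₂ b : ℝ) : frontier (box a₁ a₂ b) = box a₁ a₂ b \ openBox a₁ a₂ b := by
  rw [(isClosed_box a₁ a₂ b).frontier_eq, box_eq_reProdIm, interior_reProdIm, interior_Icc,
    interior_Icc, ← openBox_eq_reProdIm]

theorem isCompact_frontier_box (a₁ a₂ b : ℝ) : IsCompact (frontier (box a₁ a₂ b)) :=
  (isCompact_box a₁ a₂ b).of_isClosed_subset isClosed_frontier (isClosed_box a₁ a₂ b).frontier_subset

theorem openBox_disjoint_frontier {a₁ a₂ b : ℝ} {z w : ℂ} (hz : z ∈ openBox a₁ a₂ b)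
    (hw : w ∈ frontier (box a₁ a₂ b)) : w ≠ z := by
  rw [frontier_box] at hw
  rintro rfl
  exact hw.2 hz

/-! ### Contour integrals along the boundary of a rectangle. -/

section sides

variable {a₁ a₂ b : ℝ}

theorem bottom_mem_frontier (hb : 0 ≤ b) {x : ℝ} (hx : x ∈ Icc a₁ a₂) :
    (x : ℂ) - (b : ℂ) * I ∈ frontier (box a₁ a₂ b) := by
  rw [frontier_box]
  simp [box, openBox, hx.1, hx.2, abs_of_nonneg hb]

theorem top_mem_frontier (hb : 0 ≤ b) {x : ℝ} (hx : x ∈ Icc a₁ a₂) :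
    (x : ℂ) + (b : ℂ) * I ∈ frontier (box a₁ a₂ b) := by
  rw [frontier_box]
  simp [box, openBox, hx.1, hx.2, abs_of_nonneg hb]

theorem right_mem_frontier (ha : a₁ ≤ a₂) {y : ℝ} (hy : y ∈ Icc (-b) b) :
    (a₂ : ℂ) + (y : ℂ) * I ∈ frontier (box a₁ a₂ b) := by
  rw [frontier_box]
  simp [box, openBox, ha, abs_le.2 hy]

theorem left_mem_frontier (ha : a₁ ≤ a₂) {y : ℝ} (hy : y ∈ Icc (-b) b) :
    (a₁ : ℂ) + (y : ℂ) * I ∈ frontier (box a₁ a₂ b) := by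
  rw [frontier_box]
  simp [box, openBox, ha, abs_le.2 hy]

variable {E : Type*} [NormedAddCommGroup E] {f g : ℂ → E}

theorem intervalIntegrable_sides (ha : a₁ ≤ a₂) (hb : 0 ≤ b)
    (hf : ContinuousOn f (frontier (box a₁ a₂ b))) :
    IntervalIntegrable (fun x : ℝ => f ((x : ℂ) - (b : ℂ) * I)) volume a₁ a₂ ∧
    IntervalIntegrable (fun x : ℝ => f ((x : ℂ) + (b : ℂ) * I)) volume a₁ a₂ ∧
    IntervalIntegrable (fun y : ℝ => f ((a₂ : ℂ) + (y : ℂ) * I)) volume (-b) b ∧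
    IntervalIntegrable (fun y : ℝ => f ((a₁ : ℂ) + (y : ℂ) * I)) volume (-b) b := by
  have hb' : -b ≤ b := by linarith
  refine ⟨?_, ?_, ?_, ?_⟩ <;> apply ContinuousOn.intervalIntegrable
  · rw [uIcc_of_le ha]
    exact hf.comp (by fun_prop) fun x hx => bottom_mem_frontier hb hx
  · rw [uIcc_of_le ha]
    exact hf.comp (by fun_prop) fun x hx => top_mem_frontier hb hx
  · rw [uIcc_of_le hb']
    exact hf.comp (by fun_prop) fun x hx => right_mem_frontier ha hx
  · rw [uIcc_of_le hb']
    exact hf.comp (by fun_prop) fun x hx => left_mem_frontier ha hx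

variable [NormedSpace ℂ E]

theorem boxIntegral_congr (ha : a₁ ≤ a₂) (hb : 0 ≤ b)
    (h : ∀ z ∈ frontier (box a₁ a₂ b), f z = g z) :
    boxIntegral a₁ a₂ b f = boxIntegral a₁ a₂ b g := by
  have hb' : -b ≤ b := by linarith
  unfold boxIntegral
  congr 1
  · congr 1
    · congr 1
      · refine intervalIntegral.integral_congr fun x hx => h _ (bottom_mem_frontier hb ?_)
        rwa [uIcc_of_le ha] at hx
      · refine intervalIntegral.integral_congr fun x hx => h _ (top_mem_frontier hb ?_)
        rwa [uIcc_of_le ha] at hx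
    · congr 1
      refine intervalIntegral.integral_congr fun x hx => h _ (right_mem_frontier ha ?_)
      rwa [uIcc_of_le hb'] at hx
  · congr 1
    refine intervalIntegral.integral_congr fun x hx => h _ (left_mem_frontier ha ?_)
    rwa [uIcc_of_le hb'] at hx

theorem boxIntegral_sub (ha : a₁ ≤ a₂) (hb : 0 ≤ b)
    (hf : ContinuousOn f (frontier (box a₁ a₂ b))) (hg : ContinuousOn g (frontier (box a₁ a₂ b))) :
    boxIntegral a₁ a₂ b (fun z => f z - g z)
      = boxIntegral a₁ a₂ b f - boxIntegral a₁ a₂ b g := by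
  obtain ⟨f1, f2, f3, f4⟩ := intervalIntegrable_sides ha hb hf
  obtain ⟨g1, g2, g3, g4⟩ := intervalIntegrable_sides ha hb hg
  unfold boxIntegral
  rw [intervalIntegral.integral_sub f1 g1, intervalIntegral.integral_sub f2 g2,
    intervalIntegral.integral_sub f3 g3, intervalIntegral.integral_sub f4 g4]
  simp only [smul_sub]
  abel

theorem boxIntegral_clm [CompleteSpace E] {F : Type*} [NormedAddCommGroup F] [NormedSpace ℂ F]
    [CompleteSpace F]
    (ha : a₁ ≤ a₂) (hb : 0 ≤ b) (L : E →L[ℂ] F)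
    (hf : ContinuousOn f (frontier (box a₁ a₂ b))) :
    boxIntegral a₁ a₂ b (fun z => L (f z)) = L (boxIntegral a₁ a₂ b f) := by
  obtain ⟨f1, f2, f3, f4⟩ := intervalIntegrable_sides ha hb hf
  unfold boxIntegral
  rw [L.intervalIntegral_comp_comm f1, L.intervalIntegral_comp_comm f2,
    L.intervalIntegral_comp_comm f3, L.intervalIntegral_comp_comm f4]
  simp only [map_sub, map_add, map_smul]

theorem norm_boxIntegral_le (ha : a₁ ≤ a₂) (hb : 0 ≤ b) {C : ℝ}
    (h : ∀ z ∈ frontier (box a₁ a₂ b), ‖f z‖ ≤ C) :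
    ‖boxIntegral a₁ a₂ b f‖ ≤ C * (2 * (a₂ - a₁) + 4 * b) := by
  have hb' : -b ≤ b := by linarith
  have e1 : ‖∫ x in a₁..a₂, f ((x : ℂ) - (b : ℂ) * I)‖ ≤ C * |a₂ - a₁| := by
    refine intervalIntegral.norm_integral_le_of_norm_le_const fun x hx => ?_
    rw [uIoc_of_le ha] at hx
    exact h _ (bottom_mem_frontier hb (Ioc_subset_Icc_self hx))
  have e2 : ‖∫ x in a₁..a₂, f ((x : ℂ) + (b : ℂ) * I)‖ ≤ C * |a₂ - a₁| := by
    refine intervalIntegral.norm_integral_le_of_norm_le_const fun x hx => ?_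
    rw [uIoc_of_le ha] at hx
    exact h _ (top_mem_frontier hb (Ioc_subset_Icc_self hx))
  have e3 : ‖I • ∫ y in (-b)..b, f ((a₂ : ℂ) + (y : ℂ) * I)‖ ≤ C * |b - -b| := by
    rw [norm_smul, norm_I, one_mul]
    refine intervalIntegral.norm_integral_le_of_norm_le_const fun x hx => ?_
    rw [uIoc_of_le hb'] at hx
    exact h _ (right_mem_frontier ha (Ioc_subset_Icc_self hx))
  have e4 : ‖I • ∫ y in (-b)..b, f ((a₁ : ℂ) + (y : ℂ) * I)‖ ≤ C * |b - -b| := by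
    rw [norm_smul, norm_I, one_mul]
    refine intervalIntegral.norm_integral_le_of_norm_le_const fun x hx => ?_
    rw [uIoc_of_le hb'] at hx
    exact h _ (left_mem_frontier ha (Ioc_subset_Icc_self hx))
  rw [abs_of_nonneg (by linarith)] at e1 e2 e3 e4
  unfold boxIntegral
  refine (norm_sub_le _ _).trans ((add_le_add ((norm_add_le _ _).trans (add_le_add
    ((norm_sub_le _ _).trans (add_le_add e1 e2)) e3)) e4).trans ?_)
  linarith

theorem boxIntegral_eq_zero [CompleteSpace E] (ha : a₁ ≤ a₂) (hb : 0 ≤ b)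
    (hc : ContinuousOn f (box a₁ a₂ b)) (hd : DifferentiableOn ℂ f (openBox a₁ a₂ b)) :
    boxIntegral a₁ a₂ b f = 0 := by
  have hb' : -b ≤ b := by linarith
  have := integral_boundary_rect_eq_zero_of_continuousOn_of_differentiableOn f
    (a₁ - b * I) (a₂ + b * I)
    (by simpa [uIcc_of_le ha, uIcc_of_le hb', ← box_eq_reProdIm] using hc)
    (by simpa [ha, hb', ← openBox_eq_reProdIm] using hd)
  simpa [boxIntegral, sub_eq_add_neg] using this

/-- On the bottom, top and right sides the principal logarithm of ζ - w is a primitive. The left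
side crosses the cut, so log(-(ζ - w)) serves there; returning to log(ζ - w) at the two left corners
contributes πi each, and the rest cancels. -/
theorem boxIntegral_inv_sub_of_mem {w : ℂ} (hw : w ∈ openBox a₁ a₂ b) :
    boxIntegral a₁ a₂ b (fun z => (z - w)⁻¹) = 2 * Real.pi * I := by
  obtain ⟨h1, h2, h3⟩ := hw
  obtain ⟨h3, h4⟩ := abs_lt.1 h3
  have ha : a₁ ≤ a₂ := by linarith
  have hb' : -b ≤ b := by linarith
  have hb : 0 ≤ b := by linarith
  have hcont : ContinuousOn (fun z => (z - w)⁻¹) (frontier (box a₁ a₂ b)) := by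
    refine ContinuousOn.inv₀ (by fun_prop) fun z hz => sub_ne_zero.2 ?_
    exact openBox_disjoint_frontier ⟨h1, h2, abs_lt.2 ⟨h3, h4⟩⟩ hz
  obtain ⟨f1, f2, f3, f4⟩ := intervalIntegrable_sides ha hb hcont
  have e1 : (∫ x in a₁..a₂, ((x : ℂ) - (b : ℂ) * I - w)⁻¹)
      = log (a₂ - b * I - w) - log (a₁ - b * I - w) := by
    refine intervalIntegral.integral_eq_sub_of_hasDerivAt
      (f := fun x : ℝ => log (x - b * I - w)) (fun x hx => ?_) f1
    have : HasDerivAt (fun x : ℝ => (x : ℂ) - b * I - w) 1 x := by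
      simpa using (((hasDerivAt_id x).ofReal_comp).sub_const (b * I)).sub_const w
    simpa using this.clog_real (Or.inr (by simp; intro h; linarith))
  have e2 : (∫ x in a₁..a₂, ((x : ℂ) + (b : ℂ) * I - w)⁻¹)
      = log (a₂ + b * I - w) - log (a₁ + b * I - w) := by
    refine intervalIntegral.integral_eq_sub_of_hasDerivAt
      (f := fun x : ℝ => log (x + b * I - w)) (fun x hx => ?_) f2
    have : HasDerivAt (fun x : ℝ => (x : ℂ) + b * I - w) 1 x := by
      simpa using (((hasDerivAt_id x).ofReal_comp).add_const (b * I)).sub_const w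
    simpa using this.clog_real (Or.inr (by simp; intro h; linarith))
  have hI : ∀ y : ℝ, HasDerivAt (fun y : ℝ => (y : ℂ) * I) I y := fun y => by
    simpa using ((hasDerivAt_id y).ofReal_comp).mul_const I
  have e3 : I • (∫ y in (-b)..b, ((a₂ : ℂ) + (y : ℂ) * I - w)⁻¹)
      = log (a₂ + b * I - w) - log (a₂ - b * I - w) := by
    rw [← intervalIntegral.integral_smul]
    have := intervalIntegral.integral_eq_sub_of_hasDerivAt (a := -b) (b := b)
      (f := fun y : ℝ => log (a₂ + y * I - w)) (f' := fun y : ℝ => I • (a₂ + y * I - w)⁻¹)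
      (fun x hx => ?_) (f3.smul I)
    · rw [this]
      simp [sub_eq_add_neg]
    · have := ((hI x).const_add (a₂ : ℂ)).sub_const w
      simpa [div_eq_mul_inv] using this.clog_real (Or.inl (by simp; linarith))
  have e4 : I • (∫ y in (-b)..b, ((a₁ : ℂ) + (y : ℂ) * I - w)⁻¹)
      = log (-(a₁ + b * I - w)) - log (-(a₁ - b * I - w)) := by
    rw [← intervalIntegral.integral_smul]
    have := intervalIntegral.integral_eq_sub_of_hasDerivAt (a := -b) (b := b)
      (f := fun y : ℝ => log (-(a₁ + y * I - w))) (f' := fun y : ℝ => I • (a₁ + y * I - w)⁻¹)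
      (fun x hx => ?_) (f4.smul I)
    · rw [this]
      simp [sub_eq_add_neg]
    · have := (((hI x).const_add (a₁ : ℂ)).sub_const w).neg
      have := this.clog_real (Or.inl (by simp; linarith))
      simp only [Pi.neg_apply] at this
      rw [neg_div_neg_eq] at this
      simpa [div_eq_mul_inv] using this
  have e5 : log (-(a₁ + b * I - w)) = log (a₁ + b * I - w) - Real.pi * I := by
    rw [log, log, arg_neg_eq_arg_sub_pi_of_im_pos (by simp; linarith), norm_neg]
    push_cast
    ring
  have e6 : log (-(a₁ - b * I - w)) = log (a₁ - b * I - w) + Real.pi * I := by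
    rw [log, log, arg_neg_eq_arg_add_pi_of_im_neg (by simp; linarith), norm_neg]
    push_cast
    ring
  unfold boxIntegral
  rw [e1, e2, e3, e4, e5, e6]
  ring

theorem boxIntegral_inv_sub_of_notMem (ha : a₁ ≤ a₂) (hb : 0 ≤ b) {w : ℂ}
    (hw : w ∉ box a₁ a₂ b) : boxIntegral a₁ a₂ b (fun z => (z - w)⁻¹) = 0 := by
  have : DifferentiableOn ℂ (fun z => (z - w)⁻¹) (box a₁ a₂ b) := by
    refine DifferentiableOn.inv (by fun_prop) fun z hz h => hw ?_
    rwa [← sub_eq_zero.1 h]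
  exact boxIntegral_eq_zero ha hb this.continuousOn (this.mono (openBox_subset_box _ _ _))

end sides

/-! ### Holomorphy of Cauchy integrals. -/

section cauchyTransform

variable {E : Type*} [NormedAddCommGroup E] [NormedSpace ℂ E]

/-- Differentiation under the integral sign: the compact curve has a distance r > 0 from z, hence
stays r/2 away from the disc of radius r/2, and this gives a constant dominating bound. -/
theorem differentiableAt_intervalIntegral_inv_smul [CompleteSpace E] {γ : ℝ → ℂ} {f : ℝ → E}
    {a b : ℝ}
    (hγ : Continuous γ) (hf : ContinuousOn f (uIcc a b)) {z : ℂ} (hz : ∀ t ∈ uIcc a b, γ t ≠ z) :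
    DifferentiableAt ℂ (fun w => ∫ t in a..b, (γ t - w)⁻¹ • f t) z := by
  have hK : IsClosed (γ '' uIcc a b) := (isCompact_uIcc.image hγ).isClosed
  obtain ⟨r, hr, hball⟩ := Metric.isOpen_iff.1 hK.isOpen_compl z
    (by rintro ⟨t, ht, h⟩; exact hz t ht h)
  have hdist : ∀ t ∈ uIcc a b, ∀ w ∈ Metric.ball z (r / 2), r / 2 ≤ ‖γ t - w‖ := by
    intro t ht w hw
    have h1 : r ≤ dist (γ t) z := by
      by_contra! h
      exact hball h ⟨t, ht, rfl⟩
    have h2 := dist_triangle (γ t) w z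
    rw [Metric.mem_ball] at hw
    rw [← dist_eq_norm]
    linarith
  have hne : ∀ t ∈ uIcc a b, ∀ w ∈ Metric.ball z (r / 2), γ t - w ≠ 0 := fun t ht w hw h => by
    have := hdist t ht w hw
    rw [h, norm_zero] at this
    linarith
  obtain ⟨C, hC⟩ := (isCompact_uIcc (a := a) (b := b)).exists_bound_of_continuousOn hf
  have hcont : ∀ w ∈ Metric.ball z (r / 2),
      ContinuousOn (fun t => (γ t - w)⁻¹ • f t) (uIcc a b) := fun w hw =>
    (((hγ.sub continuous_const).continuousOn).inv₀ fun t ht => hne t ht w hw).smul hf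
  have hz' : z ∈ Metric.ball z (r / 2) := Metric.mem_ball_self (by linarith)
  have hmeas : ∀ g : ℝ → E, ContinuousOn g (uIcc a b) →
      AEStronglyMeasurable g (volume.restrict (uIoc a b)) := fun g hg =>
    (hg.mono uIoc_subset_uIcc).aestronglyMeasurable measurableSet_uIoc
  refine (intervalIntegral.hasDerivAt_integral_of_dominated_loc_of_deriv_le
    (F' := fun w t => ((γ t - w) ^ 2)⁻¹ • f t) (bound := fun _ => ((r / 2) ^ 2)⁻¹ * C)
    (Metric.ball_mem_nhds z (by linarith : 0 < r / 2)) ?_ (hcont z hz').intervalIntegrable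
    ?_ ?_ intervalIntegrable_const ?_).2.differentiableAt
  · filter_upwards [Metric.ball_mem_nhds z (by linarith : 0 < r / 2)] with w hw
    exact hmeas _ (hcont w hw)
  · refine hmeas _ (ContinuousOn.smul (ContinuousOn.inv₀ (by fun_prop) fun t ht => ?_) hf)
    exact pow_ne_zero 2 (hne t ht z hz')
  · refine ae_of_all _ fun t ht w hw => ?_
    have ht' := uIoc_subset_uIcc ht
    rw [norm_smul, norm_inv, norm_pow]
    gcongr
    · exact hdist t ht' w hw
    · exact hC t ht'
  · refine ae_of_all _ fun t ht w hw => ?_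
    have h := (((hasDerivAt_id w).const_sub (γ t)).inv
      (hne t (uIoc_subset_uIcc ht) w hw)).smul_const (f t)
    simpa using h

theorem differentiableAt_boxIntegral_inv_smul [CompleteSpace E] {a₁ a₂ b : ℝ} (ha : a₁ ≤ a₂)
    (hb : 0 ≤ b) {f : ℂ → E} (hf : ContinuousOn f (frontier (box a₁ a₂ b))) {z : ℂ}
    (hz : z ∉ frontier (box a₁ a₂ b)) :
    DifferentiableAt ℂ (fun w => boxIntegral a₁ a₂ b (fun ζ => (ζ - w)⁻¹ • f ζ)) z := by
  have hb' : -b ≤ b := by linarith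
  have key : ∀ (γ : ℝ → ℂ) (a c : ℝ), a ≤ c → Continuous γ →
      (∀ t ∈ Icc a c, γ t ∈ frontier (box a₁ a₂ b)) →
      DifferentiableAt ℂ (fun w => ∫ t in a..c, (γ t - w)⁻¹ • f (γ t)) z := by
    intro γ a c hac hγ hmem
    rw [← uIcc_of_le hac] at hmem
    refine differentiableAt_intervalIntegral_inv_smul hγ (hf.comp hγ.continuousOn hmem) ?_
    rintro t ht rfl
    exact hz (hmem t ht)
  have k1 := key (fun x => (x : ℂ) - (b : ℂ) * I) a₁ a₂ ha (by fun_prop)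
    fun x hx => bottom_mem_frontier hb hx
  have k2 := key (fun x => (x : ℂ) + (b : ℂ) * I) a₁ a₂ ha (by fun_prop)
    fun x hx => top_mem_frontier hb hx
  have k3 := key (fun y => (a₂ : ℂ) + (y : ℂ) * I) (-b) b hb' (by fun_prop)
    fun x hx => right_mem_frontier ha hx
  have k4 := key (fun y => (a₁ : ℂ) + (y : ℂ) * I) (-b) b hb' (by fun_prop)
    fun x hx => left_mem_frontier ha hx
  exact ((k1.sub k2).add (k3.const_smul I)).sub (k4.const_smul I)

end cauchyTransform

/-! ### Resolvents of unbounded operators. -/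

section resolvent

variable {H : Type*} [NormedAddCommGroup H] [InnerProductSpace ℂ H] {A : H →ₗ.[ℂ] H}

/-- The resolvent set of an unbounded operator. -/
def resolventSet (A : H →ₗ.[ℂ] H) : Set ℂ := {z | ∃ R : H →L[ℂ] H, IsResolventAt A z R}

theorem mem_resolventSet_iff {z : ℂ} : z ∈ resolventSet A ↔ z ∉ opSpectrum A := by
  simp [resolventSet, opSpectrum]

theorem isResolventAt_opResolvent {z : ℂ} (hz : z ∈ resolventSet A) :
    IsResolventAt A z (opResolvent A z) := by
  have hz' : ∃ R : H →L[ℂ] H, IsResolventAt A z R := hz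
  rw [opResolvent, dif_pos hz']
  exact hz'.choose_spec

theorem IsResolventAt.mem {z : ℂ} {R : H →L[ℂ] H} (h : IsResolventAt A z R) :
    z ∈ resolventSet A := ⟨R, h⟩

theorem IsResolventAt.eq {z : ℂ} {R : H →L[ℂ] H} (h : IsResolventAt A z R) :
    opResolvent A z = R := (isResolventAt_opResolvent h.mem).unique h

theorem IsResolventAt.injective {z : ℂ} {R : H →L[ℂ] H} (h : IsResolventAt A z R) :
    Function.Injective R := by
  rw [injective_iff_map_eq_zero]
  intro y hy
  obtain ⟨hy', e⟩ := h.1 y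
  have : (⟨R y, hy'⟩ : A.domain) = 0 := Subtype.ext hy
  rw [← e, this, hy]
  simp

theorem IsResolventAt.apply_eq {z : ℂ} {R : H →L[ℂ] H} (h : IsResolventAt A z R) (y : H)
    (hy : R y ∈ A.domain) : A ⟨R y, hy⟩ = z • R y - y := by
  obtain ⟨_, e⟩ := h.1 y
  nth_rw 3 [← e]
  abel

theorem IsResolventAt.exists_eq {z : ℂ} {R : H →L[ℂ] H} (h : IsResolventAt A z R)
    (x : A.domain) : ∃ y, R y = x := ⟨_, h.2 x⟩

/-- Apply R to (z - A) S y = y - (w - z) S y. -/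
theorem IsResolventAt.identity {z w : ℂ} {R S : H →L[ℂ] H} (hR : IsResolventAt A z R)
    (hS : IsResolventAt A w S) : R - S = (w - z) • (R * S) := by
  ext y
  obtain ⟨h, -⟩ := hS.1 y
  have h1 := hR.2 ⟨S y, h⟩
  rw [hS.apply_eq y h] at h1
  have h2 : z • S y - (w • S y - y) = y - (w - z) • S y := by
    rw [sub_smul]; abel
  simp only [h2, map_sub, map_smul] at h1
  simp only [sub_apply, smul_apply,
    mul_apply_eq_comp]
  rw [sub_eq_iff_eq_add] at h1 ⊢
  exact h1.trans (add_comm _ _)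

theorem IsResolventAt.commute {z w : ℂ} {R S : H →L[ℂ] H} (hR : IsResolventAt A z R)
    (hS : IsResolventAt A w S) : R * S = S * R := by
  by_cases h : w = z
  · subst h
    rw [hR.unique hS]
  · have h1 := hR.identity hS
    have h2 := hS.identity hR
    have h3 : (w - z) • (R * S) = (w - z) • (S * R) := by
      rw [← h1, ← neg_sub, h2, ← neg_smul, neg_sub]
    exact smul_right_injective _ (sub_ne_zero.2 h) h3

/-- Because A R = z R - 1, one has (w - A) R = 1 - (z - w) R; inverting the bounded factor inverts w
- A. -/
theorem IsResolventAt.of_inverse {z w : ℂ} {R X : H →L[ℂ] H} (hR : IsResolventAt A z R)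
    (h1 : (1 - (z - w) • R) * X = 1) (h2 : X * (1 - (z - w) • R) = 1) :
    IsResolventAt A w (R * X) := by
  refine ⟨fun y => ?_, fun x => ?_⟩
  · obtain ⟨h, -⟩ := hR.1 (X y)
    refine ⟨h, ?_⟩
    have := hR.apply_eq (X y) h
    have e := congrArg (fun Z : H →L[ℂ] H => Z y) h1
    simp only [mul_apply_eq_comp, sub_apply,
      one_apply_eq_self, smul_apply] at e
    change w • R (X y) - A ⟨R (X y), h⟩ = y
    refine Eq.trans ?_ e
    rw [this, sub_smul]
    abel
  · obtain ⟨u, hu⟩ := hR.exists_eq x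
    obtain ⟨h, -⟩ := hR.1 u
    have hx : x = ⟨R u, h⟩ := Subtype.ext hu.symm
    rw [hx, hR.apply_eq u h]
    have e : w • R u - (z • R u - u) = (1 - (z - w) • R) u := by
      simp [sub_smul]
      abel
    rw [e]
    change R (X ((1 - (z - w) • R) u)) = R u
    rw [← mul_apply_eq_comp X, h2, one_apply_eq_self]

/-- If `K = B (z - T)⁻¹` and `1 - s K` is invertible, then `z` is in the resolvent set of
`T + s B`. -/
theorem IsResolventAt.add_smul {T B : H →ₗ.[ℂ] H} (hTB : T.domain ≤ B.domain) {z : ℂ}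
    {R K X : H →L[ℂ] H} (hR : IsResolventAt T z R)
    (hK : ∀ (y : H) (h : R y ∈ T.domain), K y = B ⟨R y, hTB h⟩) (s : ℂ)
    (h1 : (1 - s • K) * X = 1) (h2 : X * (1 - s • K) = 1) :
    IsResolventAt (T + s • B) z (R * X) := by
  -- The factorization (z - T - sB) R = 1 - sK, from (z - T) R = 1 and B R = K.
  have key : ∀ (u : H) (h : R u ∈ (T + s • B).domain),
      z • R u - (T + s • B) ⟨R u, h⟩ = (1 - s • K) u := by
    intro u h
    rw [LinearPMap.add_apply, hR.apply_eq u h.1, LinearPMap.smul_apply]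
    have := hK u h.1
    simp only [sub_apply, one_apply_eq_self,
      smul_apply, this]
    abel
  refine ⟨fun y => ?_, fun x => ?_⟩
  · obtain ⟨h, -⟩ := hR.1 (X y)
    refine ⟨⟨h, hTB h⟩, ?_⟩
    refine (key (X y) _).trans ?_
    rw [← mul_apply_eq_comp, h1, one_apply_eq_self]
  · obtain ⟨u, hu⟩ := hR.exists_eq ⟨x, x.2.1⟩
    have hu' : R u = (x : H) := hu
    have hx : x = ⟨R u, by rw [hu']; exact x.2⟩ := Subtype.ext hu'.symm
    rw [hx, key u]
    change R (X ((1 - s • K) u)) = R u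
    rw [← mul_apply_eq_comp X, h2, one_apply_eq_self]

/-- The resolvent acts on eigenvectors by a scalar. -/
theorem IsResolventAt.apply_eigenvector {z w : ℂ} {R : H →L[ℂ] H} (hR : IsResolventAt A z R)
    {x : A.domain} (hx0 : (x : H) ≠ 0) (hx : A x = w • (x : H)) :
    z ≠ w ∧ R x = (z - w)⁻¹ • (x : H) := by
  have h := hR.2 x
  rw [hx, ← sub_smul, map_smul] at h
  have hne : z - w ≠ 0 := by
    intro h0
    rw [h0, zero_smul] at h
    exact hx0 h.symm
  refine ⟨sub_ne_zero.1 hne, ?_⟩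
  nth_rw 2 [← h]
  rw [smul_smul, inv_mul_cancel₀ hne, one_smul]

variable [CompleteSpace H]

/-- The units of the Banach algebra of bounded operators form an open set. The explicit formula is
kept because the holomorphy of the resolvent is read off from it. -/
theorem IsResolventAt.eventually {z : ℂ} {R : H →L[ℂ] H} (hR : IsResolventAt A z R) :
    ∀ᶠ w in 𝓝 z, IsResolventAt A w (R * Ring.inverse (1 - (z - w) • R)) := by
  have hcont : Continuous fun w : ℂ => 1 - (z - w) • R := by fun_prop
  have : ∀ᶠ w in 𝓝 z, IsUnit (1 - (z - w) • R) := by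
    refine hcont.continuousAt.eventually (Units.isOpen.mem_nhds ?_)
    simp
  filter_upwards [this] with w hw
  exact hR.of_inverse (Ring.mul_inverse_cancel _ hw) (Ring.inverse_mul_cancel _ hw)

theorem isOpen_resolventSet (A : H →ₗ.[ℂ] H) : IsOpen (resolventSet A) := by
  rw [isOpen_iff_mem_nhds]
  rintro z ⟨R, hR⟩
  filter_upwards [hR.eventually] with w hw
  exact hw.mem

theorem differentiableAt_opResolvent {z : ℂ} (hz : z ∈ resolventSet A) :
    DifferentiableAt ℂ (opResolvent A) z := by
  have hR := isResolventAt_opResolvent hz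
  set R := opResolvent A z with hRdef
  have h1 : DifferentiableAt ℂ (fun w : ℂ => R * Ring.inverse (1 - (z - w) • R)) z := by
    refine DifferentiableAt.const_mul ?_ _
    have h2 : DifferentiableAt ℂ (fun w : ℂ => 1 - (z - w) • R) z := by fun_prop
    have h3 : DifferentiableAt ℂ (Ring.inverse (M₀ := H →L[ℂ] H)) (1 - (z - z) • R) := by
      have : (1 - (z - z) • R) = ((1 : (H →L[ℂ] H)ˣ) : H →L[ℂ] H) := by simp
      rw [this]
      exact differentiableAt_inverse (isUnit_one)
    exact h3.comp z h2
  refine h1.congr_of_eventuallyEq ?_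
  filter_upwards [hR.eventually] with w hw
  exact hw.eq

theorem continuousOn_opResolvent (A : H →ₗ.[ℂ] H) :
    ContinuousOn (opResolvent A) (resolventSet A) :=
  fun _ hz => (differentiableAt_opResolvent hz).continuousAt.continuousWithinAt

end resolvent

/-! ### Riesz projections and the spectrum inside a contour. -/

section riesz

variable {H : Type*} [NormedAddCommGroup H] [InnerProductSpace ℂ H] [CompleteSpace H]
  {A : H →ₗ.[ℂ] H} {a₁ a₂ b : ℝ}

theorem boxProjection_eq (A : H →ₗ.[ℂ] H) (a₁ a₂ b : ℝ) :
    boxProjection A a₁ a₂ b = (2 * Real.pi * I : ℂ)⁻¹ • boxIntegral a₁ a₂ b (opResolvent A) := rfl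

/-- The part of the resolvent of `A` that is holomorphic inside of the box. -/
def regularPart (A : H →ₗ.[ℂ] H) (a₁ a₂ b : ℝ) (z : ℂ) : H →L[ℂ] H :=
  (2 * Real.pi * I : ℂ)⁻¹ • boxIntegral a₁ a₂ b fun ζ => (ζ - z)⁻¹ • opResolvent A ζ

theorem two_pi_I_inv_mul : (2 * Real.pi * I : ℂ)⁻¹ * (2 * Real.pi * I) = 1 :=
  inv_mul_cancel₀ (by simp [Real.pi_ne_zero])

theorem continuousOn_inv_sub_frontier {z : ℂ} (hz : z ∈ openBox a₁ a₂ b) :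
    ContinuousOn (fun ζ => (ζ - z)⁻¹) (frontier (box a₁ a₂ b)) :=
  ContinuousOn.inv₀ (by fun_prop) fun _ hζ =>
    sub_ne_zero.2 (openBox_disjoint_frontier hz hζ)

theorem commute_boxProjection (ha : a₁ ≤ a₂) (hb : 0 ≤ b)
    (hA : frontier (box a₁ a₂ b) ⊆ resolventSet A) {z₀ : ℂ} {R : H →L[ℂ] H}
    (hR : IsResolventAt A z₀ R) : R * boxProjection A a₁ a₂ b = boxProjection A a₁ a₂ b * R := by
  have hc := (continuousOn_opResolvent A).mono hA
  have h1 := boxIntegral_clm ha hb (ContinuousLinearMap.mul ℂ (H →L[ℂ] H) R) hc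
  have h2 := boxIntegral_clm ha hb ((ContinuousLinearMap.mul ℂ (H →L[ℂ] H)).flip R) hc
  simp only [ContinuousLinearMap.mul_apply', ContinuousLinearMap.flip_apply] at h1 h2
  rw [boxProjection_eq, mul_smul_comm, smul_mul_assoc, ← h1, ← h2]
  congr 1
  exact boxIntegral_congr ha hb fun ζ hζ => hR.commute (isResolventAt_opResolvent (hA hζ))

theorem commute_regularPart (ha : a₁ ≤ a₂) (hb : 0 ≤ b)
    (hA : frontier (box a₁ a₂ b) ⊆ resolventSet A) {z₀ : ℂ} {R : H →L[ℂ] H}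
    (hR : IsResolventAt A z₀ R) {z : ℂ} (hz : z ∈ openBox a₁ a₂ b) :
    R * regularPart A a₁ a₂ b z = regularPart A a₁ a₂ b z * R := by
  have hc : ContinuousOn (fun ζ => (ζ - z)⁻¹ • opResolvent A ζ) (frontier (box a₁ a₂ b)) :=
    (continuousOn_inv_sub_frontier hz).smul ((continuousOn_opResolvent A).mono hA)
  have h1 := boxIntegral_clm ha hb (ContinuousLinearMap.mul ℂ (H →L[ℂ] H) R) hc
  have h2 := boxIntegral_clm ha hb ((ContinuousLinearMap.mul ℂ (H →L[ℂ] H)).flip R) hc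
  simp only [ContinuousLinearMap.mul_apply', ContinuousLinearMap.flip_apply] at h1 h2
  rw [regularPart, mul_smul_comm, smul_mul_assoc, ← h1, ← h2]
  congr 1
  refine boxIntegral_congr ha hb fun ζ hζ => ?_
  rw [mul_smul_comm, smul_mul_assoc, hR.commute (isResolventAt_opResolvent (hA hζ))]

/-- `(z - A)` inverts the regular part on the range of the complementary projection. -/
theorem regularPart_eq (ha : a₁ ≤ a₂) (hb : 0 ≤ b)
    (hA : frontier (box a₁ a₂ b) ⊆ resolventSet A) {z₀ : ℂ} {R : H →L[ℂ] H}
    (hR : IsResolventAt A z₀ R) {z : ℂ} (hz : z ∈ openBox a₁ a₂ b) :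
    (1 - (z₀ - z) • R) * regularPart A a₁ a₂ b z = R * (1 - boxProjection A a₁ a₂ b) := by
  have hcR := (continuousOn_opResolvent A).mono hA
  have hci := continuousOn_inv_sub_frontier hz
  have hc : ContinuousOn (fun ζ => (ζ - z)⁻¹ • opResolvent A ζ) (frontier (box a₁ a₂ b)) :=
    hci.smul hcR
  have hcR' : ContinuousOn (fun ζ => R * opResolvent A ζ) (frontier (box a₁ a₂ b)) :=
    continuousOn_const.mul hcR
  have hci' : ContinuousOn (fun ζ => (ζ - z)⁻¹ • R) (frontier (box a₁ a₂ b)) :=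
    hci.smul continuousOn_const
  have h1 := boxIntegral_clm ha hb
    (ContinuousLinearMap.mul ℂ (H →L[ℂ] H) (1 - (z₀ - z) • R)) hc
  have h2 := boxIntegral_clm ha hb (ContinuousLinearMap.mul ℂ (H →L[ℂ] H) R) hcR
  have h3 := boxIntegral_clm ha hb (ContinuousLinearMap.toSpanSingleton ℂ R) hci
  have h4 := boxIntegral_sub ha hb hci' hcR'
  simp only [ContinuousLinearMap.mul_apply', ContinuousLinearMap.toSpanSingleton_apply]
    at h1 h2 h3
  rw [boxIntegral_inv_sub_of_mem hz] at h3
  rw [regularPart, boxProjection_eq, mul_smul_comm, ← h1, mul_sub, mul_one, mul_smul_comm, ← h2]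
  have h5 : R = (2 * Real.pi * I : ℂ)⁻¹ • (2 * Real.pi * I : ℂ) • R := by
    rw [smul_smul, two_pi_I_inv_mul, one_smul]
  nth_rw 2 [h5]
  rw [← smul_sub, ← h3, ← h4]
  congr 1
  refine boxIntegral_congr ha hb fun ζ hζ => ?_
  have hne : ζ - z ≠ 0 := sub_ne_zero.2 (openBox_disjoint_frontier hz hζ)
  have hid := hR.identity (isResolventAt_opResolvent (hA hζ))
  have hid' : opResolvent A ζ = R - (ζ - z₀) • (R * opResolvent A ζ) := by
    rw [← hid]; abel
  -- By the resolvent identity. Divided by ζ - z and integrated, the first term gives 2πi R and the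
  -- second gives R times the integral of the resolvent.
  have hsplit : ((1 - (z₀ - z) • R) * opResolvent A ζ : H →L[ℂ] H)
      = R - (ζ - z) • (R * opResolvent A ζ) := by
    rw [sub_mul, one_mul, smul_mul_assoc]
    nth_rw 1 [hid']
    rw [sub_sub, ← add_smul]
    congr 3
    ring
  rw [mul_smul_comm, hsplit, smul_sub, smul_smul, inv_mul_cancel₀ hne, one_smul]

/-- The case z₀ = z. The regular part thus continues (z - A)⁻¹ (1 - Q) holomorphically across the
spectrum inside the box. -/
theorem regularPart_eq_of_mem (ha : a₁ ≤ a₂) (hb : 0 ≤ b)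
    (hA : frontier (box a₁ a₂ b) ⊆ resolventSet A) {z : ℂ} (hz : z ∈ openBox a₁ a₂ b)
    (hz' : z ∈ resolventSet A) :
    regularPart A a₁ a₂ b z = opResolvent A z * (1 - boxProjection A a₁ a₂ b) := by
  simpa using regularPart_eq ha hb hA (isResolventAt_opResolvent hz') hz

theorem differentiableAt_regularPart (ha : a₁ ≤ a₂) (hb : 0 ≤ b)
    (hA : frontier (box a₁ a₂ b) ⊆ resolventSet A) {z : ℂ} (hz : z ∈ openBox a₁ a₂ b) :
    DifferentiableAt ℂ (regularPart A a₁ a₂ b) z :=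
  (differentiableAt_boxIntegral_inv_smul ha hb ((continuousOn_opResolvent A).mono hA)
    fun h => openBox_disjoint_frontier hz h rfl).const_smul (2 * Real.pi * I : ℂ)⁻¹

/-- The Riesz projection is idempotent. -/
theorem boxProjection_mul_self (ha : a₁ ≤ a₂) (hb : 0 ≤ b)
    (hA : frontier (box a₁ a₂ b) ⊆ resolventSet A) :
    boxProjection A a₁ a₂ b * boxProjection A a₁ a₂ b = boxProjection A a₁ a₂ b := by
  classical
  set Q := boxProjection A a₁ a₂ b with hQ
  have hc := (continuousOn_opResolvent A).mono hA
  -- F glues the regular part inside the box to (z - A)⁻¹ (1 - Q) near its boundary; both agree on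
  -- the common domain. Cauchy's theorem for F gives Q (1 - Q) = 0 with a single contour instead of
  -- two nested ones.
  let F : ℂ → H →L[ℂ] H := fun z =>
    if z ∈ openBox a₁ a₂ b then regularPart A a₁ a₂ b z else opResolvent A z * (1 - Q)
  have hF : ∀ z ∈ resolventSet A, F z = opResolvent A z * (1 - Q) := by
    intro z hz
    by_cases h : z ∈ openBox a₁ a₂ b
    · simp only [F, if_pos h]
      exact regularPart_eq_of_mem ha hb hA h hz
    · simp only [F, if_neg h]
  have hF' : ∀ z ∈ openBox a₁ a₂ b, DifferentiableAt ℂ F z := by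
    intro z hz
    refine (differentiableAt_regularPart ha hb hA hz).congr_of_eventuallyEq ?_
    filter_upwards [(isOpen_openBox a₁ a₂ b).mem_nhds hz] with w hw
    exact if_pos hw
  have h0 : boxIntegral a₁ a₂ b F = 0 := by
    refine boxIntegral_eq_zero ha hb (fun z hz => ?_)
      fun z hz => (hF' z hz).differentiableWithinAt
    by_cases h : z ∈ openBox a₁ a₂ b
    · exact (hF' z h).continuousAt.continuousWithinAt
    · have hzA : z ∈ resolventSet A := hA (by rw [frontier_box]; exact ⟨hz, h⟩)
      have h1 : ContinuousAt (fun z => opResolvent A z * (1 - Q)) z :=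
        (differentiableAt_opResolvent hzA).continuousAt.mul continuousAt_const
      refine (h1.congr ?_).continuousWithinAt
      filter_upwards [(isOpen_resolventSet A).mem_nhds hzA] with w hw
      exact (hF w hw).symm
  have h1 := boxIntegral_clm ha hb ((ContinuousLinearMap.mul ℂ (H →L[ℂ] H)).flip (1 - Q)) hc
  simp only [ContinuousLinearMap.mul_apply', ContinuousLinearMap.flip_apply] at h1
  rw [boxIntegral_congr ha hb fun ζ hζ => hF ζ (hA hζ), h1] at h0
  have h2 : Q * (1 - Q) = 0 := by
    nth_rw 1 [hQ]
    rw [boxProjection_eq, smul_mul_assoc, h0, smul_zero]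
  rw [mul_sub, mul_one, sub_eq_zero] at h2
  exact h2.symm

/-- A spectral point inside of a contour whose Riesz projection has finite rank is an eigenvalue,
with an eigenvector in the range of the Riesz projection. -/
theorem exists_eigenvector_of_mem_openBox (ha : a₁ ≤ a₂) (hb : 0 ≤ b)
    (hA : frontier (box a₁ a₂ b) ⊆ resolventSet A)
    [FiniteDimensional ℂ (LinearMap.range (boxProjection A a₁ a₂ b : H →ₗ[ℂ] H))] {w : ℂ}
    (hw : w ∈ openBox a₁ a₂ b) (hwA : w ∈ opSpectrum A) :
    ∃ x : A.domain, (x : H) ≠ 0 ∧ A x = w • (x : H) ∧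
      (x : H) ∈ LinearMap.range (boxProjection A a₁ a₂ b : H →ₗ[ℂ] H) := by
  obtain ⟨R, hR⟩ : ∃ R, IsResolventAt A _ R := hA (bottom_mem_frontier hb ⟨le_rfl, ha⟩)
  set z₀ : ℂ := (a₁ : ℂ) - (b : ℂ) * I
  set Q := boxProjection A a₁ a₂ b with hQdef
  set K := LinearMap.range (Q : H →ₗ[ℂ] H) with hK
  have hQ : Q * Q = Q := boxProjection_mul_self ha hb hA
  have hRQ : R * Q = Q * R := commute_boxProjection ha hb hA hR
  -- N = (w - A) R, so w lies in the resolvent set as soon as N is invertible. N commutes with Q and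
  -- acts on its finite-dimensional range.
  set N : H →L[ℂ] H := 1 - (z₀ - w) • R with hN
  have hNQ : N * Q = Q * N := by
    rw [hN, sub_mul, mul_sub, one_mul, mul_one, smul_mul_assoc, mul_smul_comm, hRQ]
  have hNQ' : ∀ y, N (Q y) = Q (N y) := fun y => congrArg (fun Z : H →L[ℂ] H => Z y) hNQ
  have hNK : ∀ x ∈ K, (N : H →ₗ[ℂ] H) x ∈ K := by
    rintro _ ⟨y, rfl⟩
    exact ⟨N y, (hNQ' y).symm⟩
  set M : K →ₗ[ℂ] K := (N : H →ₗ[ℂ] H).restrict hNK with hM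
  by_cases hinj : Function.Injective M
  · exfalso
    let V : K ≃ₗ[ℂ] K := LinearEquiv.ofInjectiveEndo M hinj
    have hV1 : ∀ x, M (V.symm x) = x := (LinearEquiv.ofInjectiveEndo M hinj).apply_symm_apply
    have hV2 : ∀ x, V.symm (M x) = x := (LinearEquiv.ofInjectiveEndo M hinj).symm_apply_apply
    let Qr : H →L[ℂ] K := Q.codRestrict K fun y => ⟨y, rfl⟩
    let W : H →L[ℂ] H := K.subtypeL ∘L (LinearMap.toContinuousLinearMap
      (V.symm : K →ₗ[ℂ] K)) ∘L Qr
    have hNW : N * W = Q := by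
      ext y
      exact congrArg Subtype.val (hV1 (Qr y))
    have hWN : W * N = Q := by
      ext y
      have : Qr (N y) = M (Qr y) := Subtype.ext (hNQ' y).symm
      change ((V.symm (Qr (N y)) : K) : H) = Q y
      rw [this, hV2]
      rfl
    set S := regularPart A a₁ a₂ b w with hS
    have hNS : N * S = R * (1 - Q) := regularPart_eq ha hb hA hR hw
    have hSN : S * N = R * (1 - Q) := by
      rw [← hNS, hN, sub_mul, mul_sub, one_mul, mul_one, smul_mul_assoc, mul_smul_comm,
        commute_regularPart ha hb hA hR hw]
    have hRN : ((1 : H →L[ℂ] H) - (z₀ - w) • R) = N := rfl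
    have e : N + (z₀ - w) • R = 1 := by rw [hN]; abel
    -- The inverse of N: W inverts it on the range of Q, and on the complement N (1 - Q + (z₀ - w)
    -- S) = (N + (z₀ - w) R) (1 - Q) = 1 - Q.
    refine hwA ⟨R * ((1 - Q) + (z₀ - w) • S + W), hR.of_inverse ?_ ?_⟩
    · rw [hRN, mul_add, mul_add, hNW, mul_smul_comm, hNS, ← smul_mul_assoc, ← add_mul, e, one_mul]
      abel
    · rw [hRN, add_mul, add_mul, hWN, smul_mul_assoc, hSN, ← smul_mul_assoc]
      have : (1 - Q) * N = N * (1 - Q) := by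
        rw [sub_mul 1 Q N, mul_sub N 1 Q, one_mul, mul_one, hNQ]
      rw [this, ← add_mul, e, one_mul]
      abel
  · rw [injective_iff_map_eq_zero] at hinj
    push Not at hinj
    obtain ⟨x, hx, hx0⟩ := hinj
    -- A kernel vector of N satisfies x = (z₀ - w) R x, so it lies in the domain of A and A x = w x.
    have hx' : (x : H) - (z₀ - w) • R x = 0 := congrArg Subtype.val hx
    obtain ⟨h, -⟩ := hR.1 ((z₀ - w) • (x : H))
    have hxR : R ((z₀ - w) • (x : H)) = x := by
      rw [map_smul]
      exact (sub_eq_zero.1 hx').symm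
    have hA' := hR.apply_eq _ h
    refine ⟨⟨R ((z₀ - w) • (x : H)), h⟩, ?_, ?_, ?_⟩
    · change R ((z₀ - w) • (x : H)) ≠ 0
      rw [hxR]
      exact fun h0 => hx0 (Subtype.ext h0)
    · rw [hA']
      change _ = w • R ((z₀ - w) • (x : H))
      rw [hxR, ← sub_smul]
      congr 1
      ring
    · change R ((z₀ - w) • (x : H)) ∈ K
      rw [hxR]
      exact x.2

/-- A spectral point w in the box has an eigenvector in the range of Q, so (z₀ - w)⁻¹ is an
eigenvalue of R restricted to this finite-dimensional space; there are finitely many of these. -/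
theorem finite_spectrum_inter_openBox (ha : a₁ ≤ a₂) (hb : 0 ≤ b)
    (hA : frontier (box a₁ a₂ b) ⊆ resolventSet A)
    [FiniteDimensional ℂ (LinearMap.range (boxProjection A a₁ a₂ b : H →ₗ[ℂ] H))] :
    (opSpectrum A ∩ openBox a₁ a₂ b).Finite := by
  obtain ⟨R, hR⟩ : ∃ R, IsResolventAt A _ R := hA (bottom_mem_frontier hb ⟨le_rfl, ha⟩)
  set z₀ : ℂ := (a₁ : ℂ) - (b : ℂ) * I
  set Q := boxProjection A a₁ a₂ b with hQdef
  set K := LinearMap.range (Q : H →ₗ[ℂ] H) with hK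
  have hRQ : R * Q = Q * R := commute_boxProjection ha hb hA hR
  have hRK : ∀ x ∈ K, (R : H →ₗ[ℂ] H) x ∈ K := by
    rintro _ ⟨y, rfl⟩
    exact ⟨R y, congrArg (fun Z : H →L[ℂ] H => Z y) hRQ.symm⟩
  have hfin := Module.End.finite_hasEigenvalue ((R : H →ₗ[ℂ] H).restrict hRK)
  refine Set.Finite.of_finite_image (f := fun w => (z₀ - w)⁻¹) (hfin.subset ?_) ?_
  · rintro _ ⟨w, ⟨hw, hwb⟩, rfl⟩
    obtain ⟨x, hx0, hx, hxK⟩ := exists_eigenvector_of_mem_openBox ha hb hA hwb hw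
    refine Module.End.hasEigenvalue_of_hasEigenvector (x := ⟨x, hxK⟩) ?_
    refine Module.End.hasEigenvector_iff.2 ⟨Module.End.mem_eigenspace_iff.2 (Subtype.ext ?_), ?_⟩
    · exact (hR.apply_eigenvector hx0 hx).2
    · exact fun h => hx0 (congrArg Subtype.val h)
  · intro w _ w' _ h
    simpa using h

theorem circleIntegral_clm {E F : Type*} [NormedAddCommGroup E] [NormedSpace ℂ E]
    [CompleteSpace E] [NormedAddCommGroup F] [NormedSpace ℂ F] [CompleteSpace F] (L : E →L[ℂ] F)
    {f : ℂ → E} {c : ℂ} {r : ℝ} (hf : CircleIntegrable f c r) :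
    (∮ z in C(c, r), L (f z)) = L (∮ z in C(c, r), f z) := by
  unfold circleIntegral
  rw [← L.intervalIntegral_comp_comm hf.out]
  simp only [map_smul]

/-- Inside of a contour, the Riesz projection at an isolated spectral point factors through the
Riesz projection of the contour. -/
theorem circleProjection_eq_mul (ha : a₁ ≤ a₂) (hb : 0 ≤ b)
    (hA : frontier (box a₁ a₂ b) ⊆ resolventSet A) {w : ℂ} {r : ℝ} (hr : 0 < r)
    (hwr : Metric.closedBall w r ⊆ openBox a₁ a₂ b)
    (hw : opSpectrum A ∩ Metric.closedBall w r ⊆ {w}) :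
    (∮ z in C(w, r), opResolvent A z)
        = ∮ z in C(w, r), opResolvent A z * boxProjection A a₁ a₂ b ∧
      (∮ z in C(w, r), opResolvent A z)
        = (∮ z in C(w, r), opResolvent A z) * boxProjection A a₁ a₂ b := by
  set Q := boxProjection A a₁ a₂ b with hQ
  have hsph : Metric.sphere w r ⊆ resolventSet A := by
    intro z hz
    rw [mem_resolventSet_iff]
    intro h
    have := hw ⟨h, Metric.sphere_subset_closedBall hz⟩
    rw [Set.mem_singleton_iff] at this
    rw [this, mem_sphere_iff_norm, sub_self, norm_zero] at hz
    exact hr.ne hz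
  have hci : CircleIntegrable (opResolvent A) w r :=
    ((continuousOn_opResolvent A).mono hsph).circleIntegrable hr.le
  have h1 := circleIntegral_clm ((ContinuousLinearMap.mul ℂ (H →L[ℂ] H)).flip Q) hci
  have h2 := circleIntegral_clm ((ContinuousLinearMap.mul ℂ (H →L[ℂ] H)).flip (1 - Q)) hci
  simp only [ContinuousLinearMap.mul_apply', ContinuousLinearMap.flip_apply] at h1 h2
  -- On the circle the integrand equals the regular part, which is holomorphic on the whole disc.
  have h3 : (∮ z in C(w, r), opResolvent A z * (1 - Q)) = 0 := by
    have : (∮ z in C(w, r), opResolvent A z * (1 - Q))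
        = ∮ z in C(w, r), regularPart A a₁ a₂ b z :=
      circleIntegral.integral_congr hr.le fun z hz =>
        (regularPart_eq_of_mem ha hb hA (hwr (Metric.sphere_subset_closedBall hz))
          (hsph hz)).symm
    rw [this]
    have hd : DifferentiableOn ℂ (regularPart A a₁ a₂ b) (Metric.closedBall w r) :=
      fun z hz => (differentiableAt_regularPart ha hb hA (hwr hz)).differentiableWithinAt
    exact DiffContOnCl.circleIntegral_eq_zero hr.le (hd.diffContOnCl_ball subset_rfl)
  rw [h2, mul_sub, mul_one, sub_eq_zero] at h3
  exact ⟨h3.trans h1.symm, h3⟩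

theorem exists_radius_of_mem_openBox (ha : a₁ ≤ a₂) (hb : 0 ≤ b)
    (hA : frontier (box a₁ a₂ b) ⊆ resolventSet A)
    [FiniteDimensional ℂ (LinearMap.range (boxProjection A a₁ a₂ b : H →ₗ[ℂ] H))] {w : ℂ}
    (hw : w ∈ openBox a₁ a₂ b) :
    ∃ r : ℝ, 0 < r ∧ Metric.closedBall w r ⊆ openBox a₁ a₂ b ∧
      opSpectrum A ∩ Metric.closedBall w r ⊆ {w} := by
  have hfin := (finite_spectrum_inter_openBox ha hb hA).subset
    (Set.sdiff_subset (t := {w}))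
  have hopen : IsOpen (openBox a₁ a₂ b \ ((opSpectrum A ∩ openBox a₁ a₂ b) \ {w})) :=
    (isOpen_openBox a₁ a₂ b).sdiff hfin.isClosed
  obtain ⟨r, hr, hball⟩ := Metric.nhds_basis_closedBall.mem_iff.1
    (hopen.mem_nhds (show w ∈ _ from Set.mem_sdiff_of_mem hw (by simp)))
  refine ⟨r, hr, fun z hz => (hball hz).1, ?_⟩
  rintro z ⟨hz, hzr⟩
  by_contra h
  exact (hball hzr).2 ⟨⟨hz, (hball hzr).1⟩, h⟩

theorem exists_hasAlgMultiplicity (ha : a₁ ≤ a₂) (hb : 0 ≤ b)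
    (hA : frontier (box a₁ a₂ b) ⊆ resolventSet A)
    [FiniteDimensional ℂ (LinearMap.range (boxProjection A a₁ a₂ b : H →ₗ[ℂ] H))] {w : ℂ}
    (hw : w ∈ openBox a₁ a₂ b) : ∃ m : ℕ, HasAlgMultiplicity A w m := by
  obtain ⟨r, hr, hwr, hsp⟩ := exists_radius_of_mem_openBox ha hb hA hw
  have h := (circleProjection_eq_mul ha hb hA hr hwr hsp).2
  have hlt : LinearMap.rank (((2 * Real.pi * Complex.I : ℂ)⁻¹ •
      ∮ z in C(w, r), opResolvent A z : H →L[ℂ] H) : H →ₗ[ℂ] H) < Cardinal.aleph0 := by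
    rw [h, ← smul_mul_assoc]
    refine (LinearMap.rank_comp_le_right (boxProjection A a₁ a₂ b : H →ₗ[ℂ] H) _).trans_lt ?_
    exact Module.rank_lt_aleph0 ℂ _
  obtain ⟨m, hm⟩ := Cardinal.lt_aleph0.1 hlt
  exact ⟨m, r, hr, hsp, hm⟩

/-- The range of Q is the line through an eigenvector at w, where the resolvent acts as (z - w)⁻¹.
Hence the Riesz projection at w is Q itself. -/
theorem hasAlgMultiplicity_one (ha : a₁ ≤ a₂) (hb : 0 ≤ b)
    (hA : frontier (box a₁ a₂ b) ⊆ resolventSet A)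
    (hrank : opDim (boxProjection A a₁ a₂ b) = 1) {w : ℂ}
    (hw : w ∈ openBox a₁ a₂ b) (hwA : w ∈ opSpectrum A) : HasAlgMultiplicity A w 1 := by
  have hfd : FiniteDimensional ℂ (LinearMap.range (boxProjection A a₁ a₂ b : H →ₗ[ℂ] H)) := by
    refine Module.rank_lt_aleph0_iff.1 ?_
    exact hrank.trans_lt Cardinal.one_lt_aleph0
  obtain ⟨r, hr, hwr, hsp⟩ := exists_radius_of_mem_openBox ha hb hA hw
  have h := (circleProjection_eq_mul ha hb hA hr hwr hsp).1
  obtain ⟨x, hx0, hx, hxK⟩ := exists_eigenvector_of_mem_openBox ha hb hA hw hwA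
  refine ⟨r, hr, hsp, ?_⟩
  set Q := boxProjection A a₁ a₂ b with hQ
  have hspan : ∀ y, ∃ a : ℂ, Q y = a • (x : H) := by
    obtain ⟨v, hv⟩ := rank_le_one_iff.1 hrank.le
    obtain ⟨a, ha'⟩ := hv ⟨x, hxK⟩
    have ha0 : a ≠ 0 := by
      rintro rfl
      rw [zero_smul] at ha'
      exact hx0 (congrArg Subtype.val ha').symm
    intro y
    obtain ⟨c, hc⟩ := hv ⟨Q y, y, rfl⟩
    refine ⟨c * a⁻¹, ?_⟩
    have h1 : a • (v : H) = x := congrArg Subtype.val ha'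
    have h2 : c • (v : H) = Q y := congrArg Subtype.val hc
    rw [← h1, smul_smul, mul_assoc, inv_mul_cancel₀ ha0, mul_one, h2]
  have hRQ : ∀ z ∈ Metric.sphere w r, opResolvent A z * Q = (z - w)⁻¹ • Q := by
    intro z hz
    have hzA : z ∈ resolventSet A := by
      rw [mem_resolventSet_iff]
      intro h
      have := hsp ⟨h, Metric.sphere_subset_closedBall hz⟩
      rw [Set.mem_singleton_iff] at this
      rw [this, mem_sphere_iff_norm, sub_self, norm_zero] at hz
      exact hr.ne hz
    have he := ((isResolventAt_opResolvent hzA).apply_eigenvector hx0 hx).2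
    ext y
    obtain ⟨a, hy⟩ := hspan y
    change opResolvent A z (Q y) = (z - w)⁻¹ • Q y
    rw [hy, map_smul, he, smul_comm]
  have hint : (∮ z in C(w, r), opResolvent A z) = (2 * Real.pi * I : ℂ) • Q := by
    rw [h, circleIntegral.integral_congr hr.le hRQ, circleIntegral.integral_smul_const,
      circleIntegral.integral_sub_inv_of_mem_ball (Metric.mem_ball_self hr)]
  rw [hint, smul_smul, two_pi_I_inv_mul, one_smul]
  simpa using! hrank

end riesz

/-! ### Ranks of projections and their invariance along T + sB. -/

section rank

variable {H : Type*} [NormedAddCommGroup H] [InnerProductSpace ℂ H]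

theorem apply_of_mem_range {Q : H →L[ℂ] H} (hQ : Q * Q = Q) {x : H}
    (hx : x ∈ LinearMap.range (Q : H →ₗ[ℂ] H)) : Q x = x := by
  obtain ⟨y, rfl⟩ := hx
  exact congrArg (fun Z : H →L[ℂ] H => Z y) hQ

/-- P is injective on the range of Q: if Q x = x and P x = 0, then ‖x‖ = ‖(Q - P) x‖, which forces x
= 0. -/
theorem opDim_le_of_norm_sub_lt_one {P Q : H →L[ℂ] H} (hQ : Q * Q = Q) (h : ‖Q - P‖ < 1) :
    opDim Q ≤ opDim P := by
  let f : LinearMap.range (Q : H →ₗ[ℂ] H) →ₗ[ℂ] LinearMap.range (P : H →ₗ[ℂ] H) :=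
    (P : H →ₗ[ℂ] H).rangeRestrict.comp (Submodule.subtype _)
  have hf : Function.Injective f := by
    rw [injective_iff_map_eq_zero]
    intro x hx
    have h1 : P (x : H) = 0 := congrArg Subtype.val hx
    have h2 : Q (x : H) = x := apply_of_mem_range hQ x.2
    have h3 := (Q - P).le_opNorm (x : H)
    rw [sub_apply, h1, h2, sub_zero] at h3
    by_contra hne
    have h4 : 0 < ‖(x : H)‖ := norm_pos_iff.2 fun h0 => hne (Subtype.ext h0)
    nlinarith
  exact LinearMap.rank_le_of_injective f hf

theorem opDim_eq_of_norm_sub_lt_one {P Q : H →L[ℂ] H} (hP : P * P = P) (hQ : Q * Q = Q)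
    (h : ‖Q - P‖ < 1) : opDim Q = opDim P :=
  le_antisymm (opDim_le_of_norm_sub_lt_one hQ h)
    (opDim_le_of_norm_sub_lt_one hP (by rwa [norm_sub_rev]))

variable [CompleteSpace H]

/-- Neumann series; the bound comes from X = 1 + s K X. It is uniform in s, as the Lipschitz
estimate for the resolvents requires. -/
theorem exists_inverse_one_sub_smul {K : H →L[ℂ] H} {q : ℝ} (hq : q < 1) (hK : ‖K‖ ≤ q) {s : ℂ}
    (hs : ‖s‖ ≤ 1) : ∃ X : H →L[ℂ] H, (1 - s • K) * X = 1 ∧ X * (1 - s • K) = 1 ∧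
      ‖X‖ ≤ (1 - q)⁻¹ := by
  have h1 : ‖s • K‖ ≤ q := by
    rw [norm_smul]
    nlinarith [norm_nonneg K, norm_nonneg s]
  let u := Units.oneSub (s • K) (h1.trans_lt hq)
  have hu : (u : H →L[ℂ] H) = 1 - s • K := rfl
  have hX : (1 - s • K) * (↑u⁻¹ : H →L[ℂ] H) = 1 := by rw [← hu, Units.mul_inv]
  refine ⟨↑u⁻¹, hX, by rw [← hu, Units.inv_mul], ?_⟩
  have h2 : (↑u⁻¹ : H →L[ℂ] H) = 1 + s • K * ↑u⁻¹ := by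
    rw [sub_mul, one_mul, sub_eq_iff_eq_add] at hX
    exact hX
  have h3 : ‖(↑u⁻¹ : H →L[ℂ] H)‖ ≤ 1 + q * ‖(↑u⁻¹ : H →L[ℂ] H)‖ := by
    calc ‖(↑u⁻¹ : H →L[ℂ] H)‖ = ‖1 + s • K * (↑u⁻¹ : H →L[ℂ] H)‖ := by rw [← h2]
      _ ≤ ‖(1 : H →L[ℂ] H)‖ + ‖s • K‖ * ‖(↑u⁻¹ : H →L[ℂ] H)‖ :=
        (norm_add_le _ _).trans (add_le_add le_rfl (norm_mul_le _ _))
      _ ≤ _ := add_le_add ContinuousLinearMap.norm_id_le (by gcongr)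
  rw [← mul_one (1 - q)⁻¹, le_inv_mul_iff₀ (by linarith)]
  linarith

/-- The family of operators `T + s B` has constant Riesz projection rank along a contour on which
`B (z - T)⁻¹` is uniformly a strict contraction. -/
theorem opDim_boxProjection_add {T B : H →ₗ.[ℂ] H} (hTB : T.domain ≤ B.domain)
    {a₁ a₂ b : ℝ} (ha : a₁ ≤ a₂) (hb : 0 ≤ b)
    (hT : frontier (box a₁ a₂ b) ⊆ resolventSet T) {q : ℝ} (hq0 : 0 ≤ q) (hq : q < 1)
    (hK : ∀ z ∈ frontier (box a₁ a₂ b), ∃ K : H →L[ℂ] H, ‖K‖ ≤ q ∧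
      ∀ (y : H) (h : opResolvent T z y ∈ T.domain), K y = B ⟨opResolvent T z y, hTB h⟩) :
    opDim (boxProjection (T + B) a₁ a₂ b) = opDim (boxProjection T a₁ a₂ b) := by
  obtain ⟨C, hC⟩ := (isCompact_frontier_box a₁ a₂ b).exists_bound_of_continuousOn
    ((continuousOn_opResolvent T).mono hT)
  have hC0 : 0 ≤ C := (norm_nonneg _).trans (hC _ (bottom_mem_frontier hb ⟨le_rfl, ha⟩))
  choose! K hKq hKB using hK
  let A : ℝ → H →ₗ.[ℂ] H := fun s => T + (s : ℂ) • B
  have hA1 : A 1 = T + B := by simp [A]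
  -- At s = 0 the domain is still dom T ∩ dom B, which is dom T by `hTB`.
  have hA0 : A 0 = T := by
    refine LinearPMap.ext (inf_eq_left.2 hTB) fun x hx hx' => ?_
    simp [A, LinearPMap.add_apply, LinearPMap.smul_apply]
  have hres : ∀ s : ℝ, s ∈ Set.Icc 0 1 → ∀ z ∈ frontier (box a₁ a₂ b), ∃ X : H →L[ℂ] H,
      (1 - (s : ℂ) • K z) * X = 1 ∧ X * (1 - (s : ℂ) • K z) = 1 ∧ ‖X‖ ≤ (1 - q)⁻¹ ∧
      IsResolventAt (A s) z (opResolvent T z * X) := by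
    intro s hs z hz
    have hs' : ‖(s : ℂ)‖ ≤ 1 := by
      rw [norm_real, Real.norm_of_nonneg hs.1]
      exact hs.2
    obtain ⟨X, h1, h2, h3⟩ := exists_inverse_one_sub_smul hq (hKq z hz) hs'
    exact ⟨X, h1, h2, h3, (isResolventAt_opResolvent (hT hz)).add_smul hTB (hKB z hz) s h1 h2⟩
  have hfr : ∀ s : ℝ, s ∈ Set.Icc 0 1 → frontier (box a₁ a₂ b) ⊆ resolventSet (A s) := by
    intro s hs z hz
    obtain ⟨X, -, -, -, h⟩ := hres s hs z hz
    exact h.mem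
  have hq' : 0 ≤ (1 - q)⁻¹ := inv_nonneg.2 (by linarith)
  set D : ℝ := C * ((1 - q)⁻¹ * q * (1 - q)⁻¹) with hD
  have hdiff : ∀ s : ℝ, s ∈ Set.Icc 0 1 → ∀ s' : ℝ, s' ∈ Set.Icc 0 1 →
      ∀ z ∈ frontier (box a₁ a₂ b),
      ‖opResolvent (A s) z - opResolvent (A s') z‖ ≤ |s - s'| * D := by
    intro s hs s' hs' z hz
    obtain ⟨X, h1, h2, h3, h4⟩ := hres s hs z hz
    obtain ⟨X', h1', h2', h3', h4'⟩ := hres s' hs' z hz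
    rw [h4.eq, h4'.eq]
    -- The resolvent identity in the parameter s: X - X' = X ((1 - s'K) - (1 - sK)) X'.
    have e : X - X' = ((s - s' : ℝ) : ℂ) • (X * K z * X') := by
      calc X - X' = X * ((1 - (s' : ℂ) • K z) * X') - X * (1 - (s : ℂ) • K z) * X' := by
            rw [h1', h2, mul_one, one_mul]
        _ = _ := by
            simp only [mul_sub, sub_mul, mul_one, one_mul, mul_smul_comm, smul_mul_assoc,
              mul_assoc, ofReal_sub, sub_smul]
            abel
    rw [← mul_sub, e, mul_smul_comm, norm_smul, norm_real, Real.norm_eq_abs]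
    refine mul_le_mul_of_nonneg_left ?_ (abs_nonneg _)
    refine (norm_mul_le _ _).trans (mul_le_mul (hC z hz) ?_ (norm_nonneg _) hC0)
    refine (norm_mul_le _ _).trans (mul_le_mul ?_ h3' (norm_nonneg _) (by positivity))
    exact (norm_mul_le _ _).trans (mul_le_mul h3 (hKq z hz) (norm_nonneg _) (by positivity))
  set P : ℝ → H →L[ℂ] H := fun s => boxProjection (A s) a₁ a₂ b with hP
  set M : ℝ := ‖(2 * Real.pi * I : ℂ)⁻¹‖ * (D * (2 * (a₂ - a₁) + 4 * b)) with hM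
  have hPdiff : ∀ s : ℝ, s ∈ Set.Icc 0 1 → ∀ s' : ℝ, s' ∈ Set.Icc 0 1 →
      ‖P s - P s'‖ ≤ |s - s'| * M := by
    intro s hs s' hs'
    have h1 := boxIntegral_sub ha hb ((continuousOn_opResolvent (A s)).mono (hfr s hs))
      ((continuousOn_opResolvent (A s')).mono (hfr s' hs'))
    simp only [hP, boxProjection_eq]
    rw [← smul_sub, ← h1, norm_smul]
    have h2 := norm_boxIntegral_le ha hb (hdiff s hs s' hs')
    calc _ ≤ ‖(2 * Real.pi * I : ℂ)⁻¹‖ * (|s - s'| * D * (2 * (a₂ - a₁) + 4 * b)) := by gcongr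
      _ = _ := by rw [hM]; ring
  -- With n > M, neighbours among the projections at 0, 1/n, …, 1 differ by less than 1; the maximum
  -- with 0 keeps n positive.
  obtain ⟨n, hn⟩ := exists_nat_gt (max M 0)
  have hn0 : (0 : ℝ) < n := (le_max_right _ _).trans_lt hn
  have hstep : ∀ i : ℕ, i ≤ n → opDim (P (i / n)) = opDim (P 0) := by
    intro i
    induction i with
    | zero => simp
    | succ i ih =>
      intro hi
      rw [← ih (by omega)]
      have hi' : ((i + 1 : ℕ) : ℝ) ≤ n := by exact_mod_cast hi
      push_cast at hi' ⊢
      have m1 : ((i : ℝ) + 1) / n ∈ Set.Icc (0 : ℝ) 1 :=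
        ⟨by positivity, by rw [div_le_one hn0]; exact hi'⟩
      have m2 : (i : ℝ) / n ∈ Set.Icc (0 : ℝ) 1 :=
        ⟨by positivity, by rw [div_le_one hn0]; linarith⟩
      refine opDim_eq_of_norm_sub_lt_one (boxProjection_mul_self ha hb (hfr _ m2))
        (boxProjection_mul_self ha hb (hfr _ m1)) ((hPdiff _ m1 _ m2).trans_lt ?_)
      have : ((i : ℝ) + 1) / n - i / n = 1 / n := by ring
      rw [this, abs_of_pos (by positivity), one_div, inv_mul_lt_iff₀ hn0, mul_one]
      exact (le_max_left _ _).trans_lt hn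
  have := hstep n le_rfl
  rw [div_self hn0.ne'] at this
  simpa only [hP, hA1, hA0] using this

theorem mem_resolventSet_add {T B : H →ₗ.[ℂ] H} (hTB : T.domain ≤ B.domain) {z : ℂ}
    (hT : z ∈ resolventSet T) {q : ℝ} (hq : q < 1)
    (hK : ∃ K : H →L[ℂ] H, ‖K‖ ≤ q ∧
      ∀ (y : H) (h : opResolvent T z y ∈ T.domain), K y = B ⟨opResolvent T z y, hTB h⟩) :
    z ∈ resolventSet (T + B) := by
  obtain ⟨K, hKq, hKB⟩ := hK
  obtain ⟨X, h1, h2, -⟩ := exists_inverse_one_sub_smul hq hKq (s := 1) (by simp)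
  have := (isResolventAt_opResolvent hT).add_smul hTB hKB 1 h1 h2
  rw [one_smul] at this
  exact this.mem

/-- The Riesz projection of a diagonal operator has as its rank the number of the eigenvalues
inside of the contour. -/
theorem opDim_boxProjection_diagonal {ι : Type*} {T : H →ₗ.[ℂ] H} (φ : HilbertBasis ι ℂ H)
    (t : ι → ℂ)
    (hφ : ∀ k, φ k ∈ T.domain) (hTφ : ∀ k, T ⟨φ k, hφ k⟩ = t k • φ k)
    {a₁ a₂ b : ℝ} (ha : a₁ ≤ a₂) (hb : 0 ≤ b)
    (hT : frontier (box a₁ a₂ b) ⊆ resolventSet T) (F : Finset ι)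
    (hF : ∀ k ∈ F, t k ∈ openBox a₁ a₂ b) (hF' : ∀ k ∉ F, t k ∉ box a₁ a₂ b) :
    opDim (boxProjection T a₁ a₂ b) = F.card := by
  classical
  set Q := boxProjection T a₁ a₂ b with hQ
  have hne : ∀ k, φ k ≠ 0 := fun k h0 => by simpa [h0] using φ.orthonormal.norm_eq_one k
  have hc := (continuousOn_opResolvent T).mono hT
  -- On φ_k the resolvent is multiplication by (z - t_k)⁻¹, so Q multiplies φ_k by the winding
  -- number of the contour about t_k.
  have hQφ : ∀ k, Q (φ k) = if k ∈ F then φ k else 0 := by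
    intro k
    have hRφ : ∀ z ∈ frontier (box a₁ a₂ b), z ≠ t k ∧
        opResolvent T z (φ k) = (z - t k)⁻¹ • φ k := fun z hz =>
      (isResolventAt_opResolvent (hT hz)).apply_eigenvector (x := ⟨φ k, hφ k⟩) (hne k) (hTφ k)
    have h1 := boxIntegral_clm ha hb (ContinuousLinearMap.apply ℂ H (φ k)) hc
    simp only [ContinuousLinearMap.apply_apply] at h1
    have hci : ContinuousOn (fun z => (z - t k)⁻¹) (frontier (box a₁ a₂ b)) :=
      ContinuousOn.inv₀ (by fun_prop) fun z hz => sub_ne_zero.2 (hRφ z hz).1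
    have h2 := boxIntegral_clm ha hb (ContinuousLinearMap.toSpanSingleton ℂ (φ k)) hci
    simp only [ContinuousLinearMap.toSpanSingleton_apply] at h2
    rw [hQ, boxProjection_eq, smul_apply, ← h1,
      boxIntegral_congr ha hb fun z hz => (hRφ z hz).2, h2]
    split_ifs with hk
    · rw [boxIntegral_inv_sub_of_mem (hF k hk), smul_smul, two_pi_I_inv_mul, one_smul]
    · rw [boxIntegral_inv_sub_of_notMem ha hb (hF' k hk), zero_smul, smul_zero]
  have hrange : LinearMap.range (Q : H →ₗ[ℂ] H) = Submodule.span ℂ (φ '' (F : Set ι)) := by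
    have hfd : FiniteDimensional ℂ (Submodule.span ℂ (φ '' (F : Set ι))) :=
      FiniteDimensional.span_of_finite ℂ (F.finite_toSet.image φ)
    apply le_antisymm
    · rintro _ ⟨y, rfl⟩
      have hs : HasSum (fun k => Q (φ.repr y k • φ k)) (Q y) := (φ.hasSum_repr y).mapL Q
      have hcl : IsClosed (Submodule.span ℂ (φ '' (F : Set ι)) : Set H) :=
        Submodule.closed_of_finiteDimensional _
      -- The span is finite-dimensional, hence closed, so it contains the limit Q y of sums of Q
      -- applied to basis components.
      refine hcl.mem_of_tendsto hs (Eventually.of_forall fun s => ?_)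
      refine Submodule.sum_mem _ fun k _ => ?_
      rw [map_smul, hQφ]
      split_ifs with hk
      · exact Submodule.smul_mem _ _ (Submodule.subset_span ⟨k, hk, rfl⟩)
      · rw [smul_zero]
        exact Submodule.zero_mem _
    · rw [Submodule.span_le]
      rintro _ ⟨k, hk, rfl⟩
      exact ⟨φ k, (hQφ k).trans (if_pos hk)⟩
  have hli : LinearIndependent ℂ φ := φ.orthonormal.linearIndependent
  rw [opDim, LinearMap.rank, hrange, rank_span_set (hli.linearIndepOn _).id_image,
    ← Finset.coe_image]
  refine Cardinal.mk_coe_finset.trans ?_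
  rw [Finset.card_image_of_injective _ hli.injective]

end rank

/-! ### Boundedness of B (z - T)⁻¹. -/

section relative

variable {H : Type*} [NormedAddCommGroup H] [InnerProductSpace ℂ H] [CompleteSpace H]

/-- If `B` is closed and `∑ ‖B φ_k‖² / |z - t_k|² ≤ M²`, then `B (z - T)⁻¹` is bounded by `M`. -/
theorem exists_bounded_comp_resolvent {ι : Type*} {T B : H →ₗ.[ℂ] H} (hTB : T.domain ≤ B.domain)
    (hB : B.IsClosed) (φ : HilbertBasis ι ℂ H) (t : ι → ℂ)
    (hφ : ∀ k, φ k ∈ T.domain) (hTφ : ∀ k, T ⟨φ k, hφ k⟩ = t k • φ k) {z : ℂ} {R : H →L[ℂ] H}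
    (hR : IsResolventAt T z R) {M : ℝ} (hM : 0 ≤ M)
    (hsum : ∀ s : Finset ι, ∑ k ∈ s, (‖B ⟨φ k, hTB (hφ k)⟩‖ / ‖z - t k‖) ^ 2 ≤ M ^ 2) :
    ∃ K : H →L[ℂ] H, ‖K‖ ≤ M ∧ ∀ (y : H) (h : R y ∈ T.domain), K y = B ⟨R y, hTB h⟩ := by
  have hne : ∀ k, φ k ≠ 0 := fun k h0 => by simpa [h0] using φ.orthonormal.norm_eq_one k
  have hRφ : ∀ k, R (φ k) = (z - t k)⁻¹ • φ k := fun k =>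
    (hR.apply_eigenvector (x := ⟨φ k, hφ k⟩) (hne k) (hTφ k)).2
  set β : ι → H := fun k => B ⟨φ k, hTB (hφ k)⟩ with hβ
  -- The terms of the expected series for B R y.
  set v : H → ι → H := fun y k => (φ.repr y k * (z - t k)⁻¹) • β k with hv
  have hvnorm : ∀ y k, ‖v y k‖ = ‖φ.repr y k‖ * (‖β k‖ / ‖z - t k‖) := by
    intro y k
    rw [hv, norm_smul, norm_mul, norm_inv]
    ring
  have hbessel : ∀ y (s : Finset ι), ∑ k ∈ s, ‖φ.repr y k‖ ^ 2 ≤ ‖y‖ ^ 2 := by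
    intro y s
    simp only [φ.repr_apply_apply]
    exact φ.orthonormal.sum_inner_products_le y
  -- Cauchy–Schwarz, with `hsum` for one factor and Bessel's inequality for the other.
  have hvsum : ∀ y (s : Finset ι), ∑ k ∈ s, ‖v y k‖ ≤ M * ‖y‖ := by
    intro y s
    refine abs_le_of_sq_le_sq' ?_ (by positivity) |>.2
    simp only [hvnorm]
    refine (Finset.sum_mul_sq_le_sq_mul_sq s _ _).trans ?_
    rw [mul_pow, mul_comm]
    exact mul_le_mul (hsum s) (hbessel y s) (Finset.sum_nonneg fun _ _ => sq_nonneg _)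
      (sq_nonneg M)
  have hvs : ∀ y, Summable (v y) := fun y =>
    Summable.of_norm (summable_of_sum_le (fun _ => norm_nonneg _) (hvsum y))
  -- The partial sums of R y and of the series form pairs in the graph of B; the graph is closed, so
  -- the limit pair is in it too.
  have hgraph : ∀ y, (R y, ∑' k, v y k) ∈ B.graph := by
    intro y
    have h1 : HasSum (fun k => R (φ.repr y k • φ k)) (R y) := (φ.hasSum_repr y).mapL R
    have h2 := h1.prodMk (hvs y).hasSum
    refine IsClosed.mem_of_tendsto (s := (B.graph : Set (H × H))) hB h2
      (Eventually.of_forall fun s => ?_)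
    refine Submodule.sum_mem _ fun k _ => ?_
    have h3 : (φ k, β k) ∈ B.graph := B.mem_graph ⟨φ k, hTB (hφ k)⟩
    have h4 := Submodule.smul_mem _ (φ.repr y k * (z - t k)⁻¹) h3
    rw [map_smul, hRφ, smul_smul]
    exact h4
  have hmem : ∀ y, (R : H →ₗ[ℂ] H) y ∈ B.domain := fun y =>
    LinearPMap.mem_domain_of_mem_graph (hgraph y)
  have hval : ∀ y (h : R y ∈ B.domain), B ⟨R y, h⟩ = ∑' k, v y k := fun y h =>
    B.mem_graph_snd_inj (B.mem_graph ⟨R y, h⟩) (hgraph y) rfl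
  refine ⟨(B.toFun.comp ((R : H →ₗ[ℂ] H).codRestrict B.domain hmem)).mkContinuous M fun y => ?_,
    LinearMap.mkContinuous_norm_le _ hM _, fun y h => rfl⟩
  change ‖B ⟨R y, hmem y⟩‖ ≤ M * ‖y‖
  rw [hval]
  refine le_of_tendsto (hvs y).hasSum.norm (Eventually.of_forall fun s => ?_)
  exact (norm_sum_le _ _).trans (hvsum y s)

end relative

/-! ### Lower bounds for the gaps t_n - t_k, and sums of inverse squares. -/

section estimates

/-- Power sums are bounded below in terms of their last term. -/
theorem sum_Ico_rpow_ge_last {α : ℝ} (hα : 0 < α) {k n : ℕ} (hk : 1 ≤ k) (hkn : k ≤ n) :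
    (2 : ℝ) ^ (-α) * ((n : ℝ) - k) * (n : ℝ) ^ (α - 1) ≤
      ∑ i ∈ Finset.Ico k n, (i : ℝ) ^ (α - 1) := by
  have hkn' : (k : ℝ) ≤ n := by exact_mod_cast hkn
  have hk' : (1 : ℝ) ≤ k := by exact_mod_cast hk
  have hcard : ∀ a : ℝ, ∑ _i ∈ Finset.Ico k n, a = ((n : ℝ) - k) * a := by
    intro a
    rw [Finset.sum_const, Nat.card_Ico, nsmul_eq_mul, Nat.cast_sub hkn]
  rcases le_total 1 α with h1 | h1
  -- For α ≥ 1 pair i with n + k - 1 - i: their sum is at least n, so one of the two is at least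
  -- n/2.
  · have hrefl : ∑ i ∈ Finset.Ico k n, (((n + k - 1 - i : ℕ) : ℝ)) ^ (α - 1)
        = ∑ i ∈ Finset.Ico k n, (i : ℝ) ^ (α - 1) := by
      rw [Finset.sum_Ico_reflect (fun j : ℕ => (j : ℝ) ^ (α - 1)) k (by omega)]
      congr 2 <;> omega
    have h2 : ∑ _i ∈ Finset.Ico k n, ((n : ℝ) / 2) ^ (α - 1) ≤
        ∑ i ∈ Finset.Ico k n, ((i : ℝ) ^ (α - 1) + (((n + k - 1 - i : ℕ) : ℝ)) ^ (α - 1)) := by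
      refine Finset.sum_le_sum fun i hi => ?_
      rw [Finset.mem_Ico] at hi
      have e : ((n + k - 1 - i : ℕ) : ℝ) = n + k - 1 - i := by
        rw [Nat.sub_sub, Nat.cast_sub (by omega)]
        push_cast
        ring
      have hn0 : (0 : ℝ) ≤ n := by positivity
      rcases le_total ((n : ℝ) / 2) i with h | h
      · have := Real.rpow_le_rpow (by positivity) h (sub_nonneg.2 h1)
        have : (0 : ℝ) ≤ (((n + k - 1 - i : ℕ) : ℝ)) ^ (α - 1) := by positivity
        linarith
      · have h' : (n : ℝ) / 2 ≤ ((n + k - 1 - i : ℕ) : ℝ) := by rw [e]; linarith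
        have := Real.rpow_le_rpow (by positivity) h' (sub_nonneg.2 h1)
        have : (0 : ℝ) ≤ (i : ℝ) ^ (α - 1) := by positivity
        linarith
    rw [Finset.sum_add_distrib, hrefl, hcard, Real.div_rpow (by positivity) (by norm_num)] at h2
    have e2 : (2 : ℝ) ^ (-α) = (2 * 2 ^ (α - 1))⁻¹ := by
      rw [Real.rpow_neg (by norm_num)]
      congr 1
      rw [Real.rpow_sub_one (by norm_num)]
      ring
    rw [e2, mul_inv]
    rw [div_eq_mul_inv] at h2
    linarith
  · have h2 : ∑ _i ∈ Finset.Ico k n, (n : ℝ) ^ (α - 1) ≤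
        ∑ i ∈ Finset.Ico k n, (i : ℝ) ^ (α - 1) := by
      refine Finset.sum_le_sum fun i hi => ?_
      rw [Finset.mem_Ico] at hi
      refine Real.rpow_le_rpow_of_nonpos ?_ ?_ (by linarith)
      · exact_mod_cast (by omega : 0 < i)
      · exact_mod_cast hi.2.le
    rw [hcard] at h2
    refine le_trans ?_ h2
    rw [mul_assoc]
    refine mul_le_of_le_one_left ?_ (Real.rpow_le_one_of_one_le_of_nonpos (by norm_num) (by linarith))
    exact mul_nonneg (by linarith) (by positivity)

/-- Power sums are bounded below in terms of their first term. -/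
theorem sum_Ico_rpow_ge_first {α : ℝ} (hα : 0 < α) {k n : ℕ} (hk : 1 ≤ k) (hkn : k ≤ n) :
    1 / 2 * (k : ℝ) ^ (α - 1) * min ((n : ℝ) - k) k ≤
      ∑ i ∈ Finset.Ico k n, (i : ℝ) ^ (α - 1) := by
  have hk' : (1 : ℝ) ≤ k := by exact_mod_cast hk
  -- Only indices up to 2k are kept. There each term is at least k^(α-1)/2: for α < 1 because
  -- (2k)^(α-1) ≥ 2⁻¹ k^(α-1).
  have hsub : Finset.Ico k (min n (2 * k)) ⊆ Finset.Ico k n :=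
    Finset.Ico_subset_Ico le_rfl (min_le_left _ _)
  refine le_trans ?_ (Finset.sum_le_sum_of_subset_of_nonneg hsub fun i _ _ => by positivity)
  have h2 : ∑ _i ∈ Finset.Ico k (min n (2 * k)), 1 / 2 * (k : ℝ) ^ (α - 1) ≤
      ∑ i ∈ Finset.Ico k (min n (2 * k)), (i : ℝ) ^ (α - 1) := by
    refine Finset.sum_le_sum fun i hi => ?_
    rw [Finset.mem_Ico] at hi
    have hki : (k : ℝ) ≤ i := by exact_mod_cast hi.1
    have hi2 : (i : ℝ) ≤ 2 * k := by exact_mod_cast (hi.2.trans_le (min_le_right _ _)).le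
    have hk0 : 0 ≤ (k : ℝ) ^ (α - 1) := by positivity
    rcases le_total 1 α with h1 | h1
    · have := Real.rpow_le_rpow (by positivity) hki (sub_nonneg.2 h1)
      linarith
    · have h3 := Real.rpow_le_rpow_of_nonpos (by linarith : (0 : ℝ) < i) hi2
        (by linarith : α - 1 ≤ 0)
      refine le_trans ?_ h3
      rw [Real.mul_rpow (by norm_num) (by positivity)]
      gcongr
      have h4 : (2 : ℝ) ^ (-1 : ℝ) ≤ 2 ^ (α - 1) :=
        Real.rpow_le_rpow_of_exponent_le (by norm_num) (by linarith)
      rwa [Real.rpow_neg_one, ← one_div] at h4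
  refine le_trans (le_of_eq ?_) h2
  rw [Finset.sum_const, Nat.card_Ico, nsmul_eq_mul, mul_comm, Nat.cast_sub (by omega)]
  congr 1
  push_cast
  rw [← min_sub_sub_right]
  congr 1
  ring

/-- An injective reindexing reduces this to the sum of 1/i² over positive integers; f will be k, k -
m and m + 1 - k. -/
theorem sum_inv_sq_le {ι : Type*} (s : Finset ι) (f : ι → ℕ) (hf : Set.InjOn f s)
    (hpos : ∀ k ∈ s, 0 < f k) : ∑ k ∈ s, ((f k : ℝ) ^ 2)⁻¹ ≤ 2 := by
  have h1 : ∑ i ∈ s.image f, ((i : ℝ) ^ 2)⁻¹ = ∑ k ∈ s, ((f k : ℝ) ^ 2)⁻¹ :=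
    Finset.sum_image hf
  rw [← h1]
  have h2 : s.image f ⊆ Finset.Ioo 0 ((s.image f).sup id + 1) := by
    intro i hi
    obtain ⟨k, hk, rfl⟩ := Finset.mem_image.1 hi
    exact Finset.mem_Ioo.2 ⟨hpos k hk, Nat.lt_succ_of_le (Finset.le_sup (f := id) hi)⟩
  refine (Finset.sum_le_sum_of_subset_of_nonneg h2 fun i _ _ => by positivity).trans ?_
  simpa using sum_Ioo_inv_sq_le (α := ℝ) 0 ((s.image f).sup id + 1)

theorem sum_inv_sq_pnat_le (s : Finset ℕ+) : ∑ k ∈ s, ((k : ℝ) ^ 2)⁻¹ ≤ 2 :=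
  sum_inv_sq_le s (fun k => (k : ℕ)) PNat.coe_injective.injOn fun k _ => k.pos

theorem sum_inv_sq_gt_le (s : Finset ℕ+) (m : ℕ+) (hs : ∀ k ∈ s, m < k) :
    ∑ k ∈ s, (((k : ℝ) - m) ^ 2)⁻¹ ≤ 2 := by
  have hs' : ∀ k ∈ s, (m : ℕ) < k := fun k hk => hs k hk
  have := sum_inv_sq_le s (fun k => (k : ℕ) - m) (fun k hk k' hk' h => PNat.coe_injective (by
    have := hs' k hk; have := hs' k' hk'; simp only at h; omega)) fun k hk => by
      have := hs' k hk; omega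
  refine le_trans (le_of_eq (Finset.sum_congr rfl fun k hk => ?_)) this
  rw [Nat.cast_sub (hs' k hk).le]

theorem sum_inv_sq_le_le (s : Finset ℕ+) (m : ℕ+) (hs : ∀ k ∈ s, k ≤ m) :
    ∑ k ∈ s, (((m : ℝ) + 1 - k) ^ 2)⁻¹ ≤ 2 := by
  have hs' : ∀ k ∈ s, (k : ℕ) ≤ m := fun k hk => hs k hk
  have := sum_inv_sq_le s (fun k => (m : ℕ) + 1 - k) (fun k hk k' hk' h => PNat.coe_injective (by
    have := hs' k hk; have := hs' k' hk'; simp only at h; omega)) fun k hk => by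
      have := hs' k hk; omega
  refine le_trans (le_of_eq (Finset.sum_congr rfl fun k hk => ?_)) this
  rw [Nat.cast_sub (by have := hs' k hk; omega)]
  push_cast
  rfl

variable {α κ : ℝ} {t : ℕ+ → ℝ}

theorem sum_gap_le
    (hgap : ∀ k : ℕ+, κ * (k : ℝ) ^ (α - 1) ≤ t (k + 1) - t k) (k n : ℕ+) (hkn : k ≤ n) :
    κ * ∑ i ∈ Finset.Ico (k : ℕ) n, (i : ℝ) ^ (α - 1) ≤ t n - t k := by
  induction n using PNat.recOn with
  | one =>
    obtain rfl : k = 1 := le_antisymm hkn (one_le)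
    simp
  | succ n ih =>
    rcases hkn.eq_or_lt with rfl | h
    · simp
    · have h' : k ≤ n := PNat.lt_add_one_iff.1 h
      have h'' : (k : ℕ) ≤ n := h'
      rw [PNat.add_coe, PNat.one_coe, Finset.sum_Ico_succ_top h'', mul_add]
      have := ih h'
      have := hgap n
      linarith

theorem gap_last (hα : 0 < α) (hκ : 0 < κ)
    (hgap : ∀ k : ℕ+, κ * (k : ℝ) ^ (α - 1) ≤ t (k + 1) - t k) {k n : ℕ+} (hkn : k ≤ n) :
    κ * ((2 : ℝ) ^ (-α) * ((n : ℝ) - k) * (n : ℝ) ^ (α - 1)) ≤ t n - t k :=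
  (mul_le_mul_of_nonneg_left (sum_Ico_rpow_ge_last hα k.pos hkn) hκ.le).trans
    (sum_gap_le hgap k n hkn)

theorem gap_first (hα : 0 < α) (hκ : 0 < κ)
    (hgap : ∀ k : ℕ+, κ * (k : ℝ) ^ (α - 1) ≤ t (k + 1) - t k) {k n : ℕ+} (hkn : k ≤ n) :
    κ * (1 / 2 * (k : ℝ) ^ (α - 1) * min ((n : ℝ) - k) k) ≤ t n - t k :=
  (mul_le_mul_of_nonneg_left (sum_Ico_rpow_ge_first hα k.pos hkn) hκ.le).trans
    (sum_gap_le hgap k n hkn)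

theorem pnat_rpow_pos (k : ℕ+) (a : ℝ) : 0 < (k : ℝ) ^ a :=
  Real.rpow_pos_of_pos (Nat.cast_pos.2 k.pos) a

theorem strictMono_of_gap (hκ : 0 < κ)
    (hgap : ∀ k : ℕ+, κ * (k : ℝ) ^ (α - 1) ≤ t (k + 1) - t k) : StrictMono t := by
  intro k n hkn
  have h := sum_gap_le hgap k n hkn.le
  have hkn' : (k : ℕ) < n := hkn
  have h1 : 0 < ∑ i ∈ Finset.Ico (k : ℕ) n, (i : ℝ) ^ (α - 1) := by
    refine Finset.sum_pos (fun i hi => Real.rpow_pos_of_pos ?_ _) (Finset.nonempty_Ico.2 hkn')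
    rw [Finset.mem_Ico] at hi
    exact Nat.cast_pos.2 (k.pos.trans_le hi.1)
  have := mul_pos hκ h1
  linarith

/-- The distance from the right end of the box around `t_ℓ` to the eigenvalues to the left. -/
theorem rightEnd_sub_ge (hα : 0 < α) (hκ : 0 < κ)
    (hgap : ∀ k : ℕ+, κ * (k : ℝ) ^ (α - 1) ≤ t (k + 1) - t k) {k ℓ : ℕ+} (hk : k ≤ ℓ) :
    κ / 2 * ((2 : ℝ) ^ (-α) * ((ℓ : ℝ) + 1 - k) * ((ℓ : ℝ) + 1) ^ (α - 1)) ≤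
      rightEnd α κ t ℓ - t k := by
  have hk' : (k : ℕ) ≤ ℓ := hk
  have h1 := sum_gap_le hgap k ℓ hk
  -- The half gap added in the right end supplies the summand i = ℓ, whence the bound in terms of ℓ
  -- + 1.
  have h2 := sum_Ico_rpow_ge_last hα (k := (k : ℕ)) (n := (ℓ : ℕ) + 1) k.pos (hk'.trans (Nat.le_succ _))
  rw [Finset.sum_Ico_succ_top hk'] at h2
  push_cast at h2
  have h3 : 0 ≤ ∑ i ∈ Finset.Ico (k : ℕ) ℓ, (i : ℝ) ^ (α - 1) :=
    Finset.sum_nonneg fun i _ => by positivity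
  have h4 := mul_le_mul_of_nonneg_left h2 (half_pos hκ).le
  have h5 := mul_nonneg hκ.le h3
  unfold rightEnd
  linarith

/-- The distance from the right end of the box around `t_ℓ` to the eigenvalues to the right. -/
theorem sub_rightEnd_ge (hα : 0 < α) (hκ : 0 < κ)
    (hgap : ∀ k : ℕ+, κ * (k : ℝ) ^ (α - 1) ≤ t (k + 1) - t k) {k ℓ : ℕ+} (hk : ℓ < k) :
    κ / 2 * ((2 : ℝ) ^ (-α) * ((k : ℝ) - ℓ) * (k : ℝ) ^ (α - 1)) ≤
      t k - rightEnd α κ t ℓ := by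
  have hk' : (ℓ : ℕ) < k := hk
  have h1 := sum_gap_le hgap ℓ k hk.le
  have h2 := sum_Ico_rpow_ge_last hα (k := (ℓ : ℕ)) (n := (k : ℕ)) ℓ.pos hk'.le
  have h3 : ((ℓ : ℕ) : ℝ) ^ (α - 1) ≤ ∑ i ∈ Finset.Ico (ℓ : ℕ) k, (i : ℝ) ^ (α - 1) :=
    Finset.single_le_sum (f := fun i : ℕ => (i : ℝ) ^ (α - 1)) (fun i _ => by positivity)
      (Finset.mem_Ico.2 ⟨le_rfl, hk'⟩)
  have h4 := mul_le_mul_of_nonneg_left h2 (half_pos hκ).le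
  have h5 := mul_le_mul_of_nonneg_left h3 (half_pos hκ).le
  unfold rightEnd
  -- One half of the gap sum pays for the half gap (κ/2) ℓ^(α-1), which is half of its first
  -- summand; the other half is the bound.
  have e : ∀ S : ℝ, κ * S = κ / 2 * S + κ / 2 * S := fun S => by ring
  rw [e] at h1
  linarith

/-- For n ≥ 2 the gaps give t_n - t_1 ≥ κ 2^(-α) (n - 1) n^(α-1) ≥ κ 2^(-α) n^α / 2, which is
unbounded as α > 0. -/
theorem exists_lt_of_gap (hα : 0 < α) (hκ : 0 < κ)
    (hgap : ∀ k : ℕ+, κ * (k : ℝ) ^ (α - 1) ≤ t (k + 1) - t k) (x : ℝ) : ∃ n, x < t n := by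
  have hlim : Tendsto (fun n : ℕ => (n : ℝ) ^ α) atTop atTop :=
    (tendsto_rpow_atTop hα).comp tendsto_natCast_atTop_atTop
  have hpos : 0 < κ * 2 ^ (-α) / 2 := by positivity
  obtain ⟨n, hn, hn2⟩ := ((hlim.eventually_gt_atTop ((x - t 1) / (κ * 2 ^ (-α) / 2))).and
    (eventually_ge_atTop 2)).exists
  lift n to ℕ+ using (by omega)
  refine ⟨n, ?_⟩
  rw [div_lt_iff₀ hpos] at hn
  have h := gap_last hα hκ hgap (one_le (a := n))
  have hn2' : (2 : ℝ) ≤ n := by exact_mod_cast hn2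
  have e : (n : ℝ) ^ α = n * (n : ℝ) ^ (α - 1) := by
    rw [Real.rpow_sub_one (by linarith)]
    field_simp
  simp only [PNat.one_coe, Nat.cast_one] at h
  have h6 : 0 ≤ κ * (2 : ℝ) ^ (-α) * (n : ℝ) ^ (α - 1) := by positivity
  have h7 : (n : ℝ) / 2 ≤ n - 1 := by linarith
  have h8 := mul_le_mul_of_nonneg_right h7 h6
  rw [e] at hn
  linarith

theorem exists_between (hα : 0 < α) (hκ : 0 < κ)
    (hgap : ∀ k : ℕ+, κ * (k : ℝ) ^ (α - 1) ≤ t (k + 1) - t k) {x : ℝ} {ℓ : ℕ+} (hx : t ℓ ≤ x) :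
    ∃ m, ℓ ≤ m ∧ t m ≤ x ∧ x < t (m + 1) := by
  by_contra! h
  have key : ∀ n, ℓ ≤ n → t n ≤ x := by
    intro n
    induction n using PNat.recOn with
    | one =>
      intro hn
      obtain rfl : ℓ = 1 := le_antisymm hn (one_le)
      exact hx
    | succ n ih =>
      intro hn
      rcases hn.eq_or_lt with rfl | h'
      · exact hx
      · exact h n (PNat.lt_add_one_iff.1 h') (ih (PNat.lt_add_one_iff.1 h'))
  obtain ⟨n, hn⟩ := exists_lt_of_gap hα hκ hgap x
  rcases le_total ℓ n with h' | h'
  · exact absurd (key n h') (not_le.2 hn)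
  · have := (strictMono_of_gap hκ hgap).monotone h'
    linarith

end estimates

/-! ### The sum of ‖B φ_k‖² / |z - t_k|² outside the open boxes. -/

section localization

variable {α κ : ℝ} {t c : ℕ+ → ℝ}

/-- The factor 4^α of D cancels the square of the 2^(-α) in the distance bounds, and α² + 1/α ≥ 1.
-/
theorem le_threshold_mul (hα : 0 < α) : 1024 ≤ threshold α * ((2 : ℝ) ^ (-α)) ^ 2 := by
  have h1 : (4 : ℝ) ^ α * ((2 : ℝ) ^ (-α)) ^ 2 = 1 := by
    have : (4 : ℝ) ^ α = (2 ^ α) ^ 2 := by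
      rw [← Real.rpow_natCast, ← Real.rpow_mul (by norm_num), mul_comm, Real.rpow_mul (by norm_num)]
      norm_num
    rw [this, ← mul_pow, ← Real.rpow_add (by norm_num)]
    simp
  have h2 : 1 ≤ α ^ 2 + 1 / α := by
    rcases le_total 1 α with h | h
    · have : 0 < 1 / α := by positivity
      nlinarith
    · have : 1 ≤ 1 / α := by rwa [le_div_iff₀ hα, one_mul]
      nlinarith [sq_nonneg α]
  unfold threshold
  calc (1024 : ℝ) ≤ 1024 * (α ^ 2 + 1 / α) := by linarith
    _ = 1024 * (4 ^ α * ((2 : ℝ) ^ (-α)) ^ 2) * (α ^ 2 + 1 / α) := by rw [h1, mul_one]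
    _ = _ := by ring

/-- The estimate for indices with small c_k: a is c_k, x is k^(α-1), and r measures how far k is
from z in index. The constant is 64 = 1024 / 4². -/
theorem term_le_of_threshold (hα : 0 < α) (hκ : 0 < κ) {a x r d : ℝ}
    (ha : threshold α * a ^ 2 ≤ κ ^ 2) (hx : 0 < x) (hr : 0 < r)
    (hd : κ / 4 * ((2 : ℝ) ^ (-α) * r * x) ≤ d) : (a * x / d) ^ 2 ≤ 1 / 64 * (r ^ 2)⁻¹ := by
  set e := (2 : ℝ) ^ (-α) with he
  have he0 : 0 < e := by positivity
  have hd0 : 0 < κ / 4 * (e * r * x) := by positivity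
  have h1 : 1024 * a ^ 2 ≤ e ^ 2 * κ ^ 2 := by
    calc 1024 * a ^ 2 ≤ threshold α * e ^ 2 * a ^ 2 := by gcongr; exact le_threshold_mul hα
      _ = e ^ 2 * (threshold α * a ^ 2) := by ring
      _ ≤ _ := by gcongr
  rw [div_pow, div_le_iff₀ (by have := hd0.trans_le hd; positivity)]
  calc (a * x) ^ 2 = a ^ 2 * x ^ 2 := by ring
    _ ≤ (e ^ 2 * κ ^ 2 / 1024) * x ^ 2 := by gcongr; linarith
    _ = 1 / 64 * (r ^ 2)⁻¹ * (κ / 4 * (e * r * x)) ^ 2 := by field_simp; norm_num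
    _ ≤ _ := by gcongr

/-- The estimate for the early indices, where c_k may be large. There k^(2α) ≤ V^α, and c_k² costs
another V^α; the squared distance contains L^(2α), which absorbs both. -/
theorem term_le_of_sq_lt (hα : 0 < α) (hκ : 0 < κ) {a V L d : ℝ} {k : ℕ+}
    (hk : (k : ℝ) ^ 2 < V) (hV : V ≤ L) (ha : threshold α * a ^ 2 ≤ κ ^ 2 * V ^ α)
    (hd : κ / 4 * ((2 : ℝ) ^ (-α) * L ^ α) ≤ d) :
    (a * (k : ℝ) ^ (α - 1) / d) ^ 2 ≤ 1 / 64 * ((k : ℝ) ^ 2)⁻¹ := by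
  set e := (2 : ℝ) ^ (-α) with he
  have hk0 : (0 : ℝ) < k := Nat.cast_pos.2 k.pos
  have he0 : 0 < e := by positivity
  have hV0 : 0 < V := (by positivity : (0 : ℝ) < (k : ℝ) ^ 2).trans hk
  have hL0 : 0 < L := hV0.trans_le hV
  have hd0 : 0 < κ / 4 * (e * L ^ α) := by positivity
  have hVL : V ^ α ≤ L ^ α := Real.rpow_le_rpow hV0.le hV hα.le
  have hkV : ((k : ℝ) ^ α) ^ 2 ≤ V ^ α := by
    have : ((k : ℝ) ^ α) ^ 2 = ((k : ℝ) ^ 2) ^ α := by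
      rw [← Real.rpow_natCast, ← Real.rpow_natCast, ← Real.rpow_mul hk0.le, ← Real.rpow_mul hk0.le,
        mul_comm]
    rw [this]
    exact Real.rpow_le_rpow (by positivity) hk.le hα.le
  have h1 : 1024 * a ^ 2 ≤ e ^ 2 * (κ ^ 2 * V ^ α) := by
    calc 1024 * a ^ 2 ≤ threshold α * e ^ 2 * a ^ 2 := by gcongr; exact le_threshold_mul hα
      _ = e ^ 2 * (threshold α * a ^ 2) := by ring
      _ ≤ _ := by gcongr
  rw [div_pow, div_le_iff₀ (by have := hd0.trans_le hd; positivity), Real.rpow_sub_one hk0.ne']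
  calc (a * ((k : ℝ) ^ α / k)) ^ 2 = a ^ 2 * ((k : ℝ) ^ α) ^ 2 * ((k : ℝ) ^ 2)⁻¹ := by
        field_simp
    _ ≤ (e ^ 2 * (κ ^ 2 * V ^ α) / 1024) * V ^ α * ((k : ℝ) ^ 2)⁻¹ := by
        gcongr; linarith
    _ ≤ (e ^ 2 * (κ ^ 2 * L ^ α) / 1024) * L ^ α * ((k : ℝ) ^ 2)⁻¹ := by gcongr
    _ = 1 / 64 * ((k : ℝ) ^ 2)⁻¹ * (κ / 4 * (e * L ^ α)) ^ 2 := by field_simp; norm_num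
    _ ≤ _ := by gcongr

theorem abs_re_sub_le_norm (z : ℂ) (x : ℝ) : |z.re - x| ≤ ‖z - x‖ := by
  simpa using Complex.abs_re_le_norm (z - x)

theorem abs_im_le_norm_sub (z : ℂ) (x : ℝ) : |z.im| ≤ ‖z - x‖ := by
  simpa using Complex.abs_im_le_norm (z - x)

/-- The distance to the eigenvalues to the right of `z`. -/
theorem norm_sub_ge_right (hα : 0 < α) (hκ : 0 < κ)
    (hgap : ∀ k : ℕ+, κ * (k : ℝ) ^ (α - 1) ≤ t (k + 1) - t k) {m k : ℕ+} {z : ℂ}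
    (hz : z.re < t (m + 1)) (hm : z ∉ openBox (leftEnd α κ t (m + 1)) (rightEnd α κ t (m + 1))
      (halfHeight α κ (m + 1))) (hk : m < k) :
    κ / 4 * ((2 : ℝ) ^ (-α) * ((k : ℝ) - m) * (k : ℝ) ^ (α - 1)) ≤ ‖z - t k‖ := by
  have hm1 : (1 : ℝ) ≤ m := by exact_mod_cast m.pos
  have hx : ∀ j : ℕ+, 0 < (j : ℝ) ^ (α - 1) := fun j => pnat_rpow_pos j _
  have he0 : (0 : ℝ) < 2 ^ (-α) := by positivity
  have he1 : (2 : ℝ) ^ (-α) ≤ 1 :=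
    Real.rpow_le_one_of_one_le_of_nonpos (by norm_num) (by linarith)
  rcases (PNat.add_one_le_iff.2 hk).eq_or_lt with rfl | hlt
  · have e : (((m + 1 : ℕ+) : ℕ) : ℝ) - m = 1 := by simp
    rw [e, mul_one]
    have hright : z.re < rightEnd α κ t (m + 1) := by
      have := mul_pos (half_pos hκ) (hx (m + 1))
      unfold rightEnd
      linarith
    -- For k = m + 1, z is either above or below the box, or at least (κ/2) m^(α-1) to the left of
    -- t_(m+1).
    by_cases hleft : leftEnd α κ t (m + 1) < z.re
    · have h1 : halfHeight α κ (m + 1) ≤ |z.im| := by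
        by_contra! h
        exact hm ⟨hleft, hright, h⟩
      refine le_trans ?_ (h1.trans (abs_im_le_norm_sub z _))
      unfold halfHeight
      have h2 := mul_le_mul_of_nonneg_right he1 (hx (m + 1)).le
      have h3 := mul_le_mul_of_nonneg_left h2 hκ.le
      have := mul_pos hκ (hx (m + 1))
      linarith
    · have h1 : t (m + 1) - z.re ≤ ‖z - t (m + 1)‖ := by
        refine le_trans ?_ (abs_re_sub_le_norm z _)
        rw [abs_sub_comm]
        exact le_abs_self _
      refine le_trans ?_ h1
      have h2 : κ / 2 * (m : ℝ) ^ (α - 1) ≤ t (m + 1) - z.re := by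
        have : leftEnd α κ t (m + 1) = t (m + 1) - κ / 2 * (m : ℝ) ^ (α - 1) := by
          unfold leftEnd
          congr 3
          simp [hm1]
        rw [this] at hleft
        linarith
      refine le_trans ?_ h2
      -- Replaces m^(α-1) by (m+1)^(α-1); for α ≥ 1 this uses m + 1 ≤ 2m.
      have h3 : (2 : ℝ) ^ (-α) * (((m + 1 : ℕ+) : ℕ) : ℝ) ^ (α - 1) ≤ (m : ℝ) ^ (α - 1) := by
        rcases le_total 1 α with h | h
        · have h4 : (((m + 1 : ℕ+) : ℕ) : ℝ) ^ (α - 1) ≤ (2 * m) ^ (α - 1) :=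
            Real.rpow_le_rpow (by positivity) (by push_cast; linarith) (by linarith)
          rw [Real.mul_rpow (by norm_num) (by positivity)] at h4
          calc _ ≤ (2 : ℝ) ^ (-α) * (2 ^ (α - 1) * (m : ℝ) ^ (α - 1)) := by gcongr
            _ = 2 ^ (-1 : ℝ) * (m : ℝ) ^ (α - 1) := by
                rw [← mul_assoc, ← Real.rpow_add (by norm_num)]
                congr 2
                ring
            _ ≤ _ := by
                rw [Real.rpow_neg_one]
                have := hx m
                linarith
        · have h4 : (((m + 1 : ℕ+) : ℕ) : ℝ) ^ (α - 1) ≤ (m : ℝ) ^ (α - 1) :=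
            Real.rpow_le_rpow_of_nonpos (by linarith) (by push_cast; linarith) (by linarith)
          exact (mul_le_of_le_one_left (hx _).le he1).trans h4
      have h5 := mul_le_mul_of_nonneg_left h3 hκ.le
      have := mul_pos hκ (hx m)
      linarith
  · have h1 : t k - t (m + 1) ≤ ‖z - t k‖ := by
      refine le_trans ?_ (abs_re_sub_le_norm z _)
      rw [abs_sub_comm]
      exact le_trans (by linarith) (le_abs_self _)
    refine le_trans ?_ ((gap_last hα hκ hgap hlt.le).trans h1)
    have h2 : (m : ℝ) + 2 ≤ k := by
      have : (m : ℕ) + 1 < k := hlt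
      exact_mod_cast this
    have h3 : (0 : ℝ) < κ * 2 ^ (-α) * (k : ℝ) ^ (α - 1) := by have := hx k; positivity
    have h4 : ((k : ℝ) - m) / 4 ≤ (k : ℝ) - ((m + 1 : ℕ+) : ℕ) := by
      push_cast
      linarith
    have h5 := mul_le_mul_of_nonneg_right h4 h3.le
    linarith

/-- The distance to the eigenvalues to the left of `z`. -/
theorem norm_sub_ge_left (hα : 0 < α) (hκ : 0 < κ)
    (hgap : ∀ k : ℕ+, κ * (k : ℝ) ^ (α - 1) ≤ t (k + 1) - t k) {m k : ℕ+} {z : ℂ}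
    (hz : t m ≤ z.re) (hm : z ∉ openBox (leftEnd α κ t m) (rightEnd α κ t m)
      (halfHeight α κ m) ∨ rightEnd α κ t m ≤ z.re) (hk : k ≤ m) :
    κ / 4 * ((2 : ℝ) ^ (-α) * min ((m : ℝ) + 1 - k) k * (k : ℝ) ^ (α - 1)) ≤ ‖z - t k‖ := by
  have hk1 : (1 : ℝ) ≤ k := by exact_mod_cast k.pos
  have hx : ∀ j : ℕ+, 0 < (j : ℝ) ^ (α - 1) := fun j => pnat_rpow_pos j _
  have he0 : (0 : ℝ) < 2 ^ (-α) := by positivity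
  have he1 : (2 : ℝ) ^ (-α) ≤ 1 :=
    Real.rpow_le_one_of_one_le_of_nonpos (by norm_num) (by linarith)
  have hkm : (k : ℝ) ≤ m := by exact_mod_cast hk
  have hmin0 : 0 < min ((m : ℝ) + 1 - k) k := lt_min (by linarith) (by linarith)
  -- The factor 2^(-α) is not needed on this side; it is carried only to fit `term_le_of_threshold`.
  have hdrop : κ / 4 * ((2 : ℝ) ^ (-α) * min ((m : ℝ) + 1 - k) k * (k : ℝ) ^ (α - 1)) ≤
      κ / 4 * (min ((m : ℝ) + 1 - k) k * (k : ℝ) ^ (α - 1)) := by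
    have := hx k
    gcongr
    exact mul_le_of_le_one_left hmin0.le he1
  refine hdrop.trans ?_
  rcases hk.eq_or_lt with rfl | hlt
  · have hmin1 : min ((k : ℝ) + 1 - k) k = 1 := by
      rw [add_sub_cancel_left]
      exact min_eq_left hk1
    rw [hmin1, one_mul]
    have h0 : κ / 4 * (k : ℝ) ^ (α - 1) ≤ κ / 2 * (k : ℝ) ^ (α - 1) := by
      have := hx k
      gcongr
      norm_num
    refine h0.trans ?_
    have hleft : leftEnd α κ t k < z.re := by
      have : 0 < κ / 2 * (max ((k : ℝ) - 1) 1) ^ (α - 1) := by positivity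
      unfold leftEnd
      linarith
    by_cases hright : z.re < rightEnd α κ t k
    · have h1 : halfHeight α κ k ≤ |z.im| := by
        by_contra! h
        rcases hm with hm | hm
        · exact hm ⟨hleft, hright, h⟩
        · linarith
      exact h1.trans (abs_im_le_norm_sub z _)
    · refine le_trans ?_ ((le_abs_self _).trans (abs_re_sub_le_norm z _))
      unfold rightEnd at hright
      linarith
  · have h1 : t m - t k ≤ ‖z - t k‖ :=
      le_trans (by linarith) ((le_abs_self _).trans (abs_re_sub_le_norm z _))
    refine le_trans ?_ ((gap_first hα hκ hgap hk).trans h1)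
    have h2 : (k : ℝ) + 1 ≤ m := by
      have : (k : ℕ) < m := hlt
      exact_mod_cast this
    have h3 : min ((m : ℝ) + 1 - k) k / 2 ≤ min ((m : ℝ) - k) k := by
      refine le_min ?_ ?_
      · have := min_le_left ((m : ℝ) + 1 - k) k
        linarith
      · have := min_le_right ((m : ℝ) + 1 - k) k
        linarith
    have h4 : (0 : ℝ) < κ * (k : ℝ) ^ (α - 1) := mul_pos hκ (hx k)
    have h5 := mul_le_mul_of_nonneg_right h3 h4.le
    linarith

theorem inv_sq_min_le {a b : ℝ} (ha : 0 < a) (hb : 0 < b) :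
    ((min a b) ^ 2)⁻¹ ≤ (a ^ 2)⁻¹ + (b ^ 2)⁻¹ := by
  have h1 : 0 < (a ^ 2)⁻¹ := by positivity
  have h2 : 0 < (b ^ 2)⁻¹ := by positivity
  rcases min_choice a b with h | h <;> rw [h] <;> linarith

/-- The sum that controls `B (z - T)⁻¹`, to the right of the big box and outside of the small
ones. -/
theorem sum_le_of_right (hα : 0 < α) (hκ : 0 < κ)
    (hgap : ∀ k : ℕ+, κ * (k : ℝ) ^ (α - 1) ≤ t (k + 1) - t k) {V : ℝ} {ℓ : ℕ+}
    (h1 : ∀ k, threshold α * c k ^ 2 ≤ κ ^ 2 ∨ (k : ℝ) ^ 2 < V) (h2 : V ≤ ℓ + 1)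
    (h3 : ∀ k, threshold α * c k ^ 2 ≤ κ ^ 2 * V ^ α) {z : ℂ}
    (hz : rightEnd α κ t ℓ ≤ z.re)
    (hsmall : ∀ j, ℓ < j →
      z ∉ openBox (leftEnd α κ t j) (rightEnd α κ t j) (halfHeight α κ j)) (s : Finset ℕ+) :
    ∑ k ∈ s, (c k * (k : ℝ) ^ (α - 1) / ‖z - t k‖) ^ 2 ≤ 1 / 2 := by
  have hx : ∀ j : ℕ+, 0 < (j : ℝ) ^ (α - 1) := fun j => pnat_rpow_pos j _
  have htℓ : t ℓ ≤ z.re := by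
    have := mul_pos (half_pos hκ) (hx ℓ)
    unfold rightEnd at hz
    linarith
  obtain ⟨m, hℓm, hm, hm'⟩ := exists_between hα hκ hgap htℓ
  -- The box of ℓ is not among the excluded ones; if m = ℓ, its role is taken by Re z lying beyond
  -- its right end.
  have hmbox : z ∉ openBox (leftEnd α κ t m) (rightEnd α κ t m) (halfHeight α κ m) ∨
      rightEnd α κ t m ≤ z.re := by
    rcases hℓm.eq_or_lt with rfl | h
    · exact Or.inr hz
    · exact Or.inl (hsmall m h)
  -- Beyond ℓ the exceptional case is impossible: k² ≥ k ≥ ℓ + 1 ≥ V.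
  have hgood : ∀ k, ℓ < k → threshold α * c k ^ 2 ≤ κ ^ 2 := by
    intro k hk
    refine (h1 k).resolve_right fun h => ?_
    have hk' : (ℓ : ℝ) + 1 ≤ k := by
      have : (ℓ : ℕ) < k := hk
      exact_mod_cast this
    have : (1 : ℝ) ≤ k := by exact_mod_cast k.pos
    nlinarith
  have hright : ∀ k, m < k → (c k * (k : ℝ) ^ (α - 1) / ‖z - t k‖) ^ 2 ≤
      1 / 64 * (((k : ℝ) - m) ^ 2)⁻¹ := by
    intro k hk
    have hk' : (m : ℝ) < k := by exact_mod_cast hk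
    exact term_le_of_threshold hα hκ (hgood k (hℓm.trans_lt hk)) (hx k) (sub_pos.2 hk')
      (norm_sub_ge_right hα hκ hgap hm' (hsmall _ (PNat.lt_add_one_iff.2 hℓm)) hk)
  have hleft : ∀ k, k ≤ m → (c k * (k : ℝ) ^ (α - 1) / ‖z - t k‖) ^ 2 ≤
      1 / 64 * ((((m : ℝ) + 1 - k) ^ 2)⁻¹ + ((k : ℝ) ^ 2)⁻¹) := by
    intro k hk
    have hkm : (k : ℝ) ≤ m := by exact_mod_cast hk
    have hk0 : (0 : ℝ) < k := Nat.cast_pos.2 k.pos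
    have hpos : (0 : ℝ) < (((m : ℝ) + 1 - k) ^ 2)⁻¹ := by
      have : 0 < (m : ℝ) + 1 - k := by linarith
      positivity
    rcases h1 k with h | h
    · refine (term_le_of_threshold hα hκ h (hx k) (lt_min (by linarith) hk0)
        (norm_sub_ge_left hα hκ hgap hm hmbox hk)).trans ?_
      have := inv_sq_min_le (a := (m : ℝ) + 1 - k) (by linarith) hk0
      linarith
    · have hkk : (k : ℝ) ^ 2 < ℓ + 1 := h.trans_le h2
      have hkℓ : (k : ℝ) ^ 2 ≤ ℓ := by
        have : (k : ℕ) ^ 2 < ℓ + 1 := by exact_mod_cast hkk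
        exact_mod_cast Nat.lt_succ_iff.1 this
      have hk1 : (1 : ℝ) ≤ k := by exact_mod_cast k.pos
      have hkleℓ : k ≤ ℓ := by
        have : (k : ℝ) ≤ ℓ := by nlinarith
        exact_mod_cast this
      have hd := rightEnd_sub_ge hα hκ hgap hkleℓ
      have hL : (0 : ℝ) < (ℓ : ℝ) + 1 := by positivity
      have hd' : κ / 4 * ((2 : ℝ) ^ (-α) * ((ℓ : ℝ) + 1) ^ α) ≤ ‖z - t k‖ := by
        refine le_trans ?_ (hd.trans (le_trans (by linarith)
          ((le_abs_self _).trans (abs_re_sub_le_norm z _))))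
        have e : ((ℓ : ℝ) + 1) ^ α = ((ℓ : ℝ) + 1) * ((ℓ : ℝ) + 1) ^ (α - 1) := by
          rw [Real.rpow_sub_one hL.ne']
          field_simp
        -- From 2k ≤ k² + 1 ≤ ℓ + 1.
        have h4 : ((ℓ : ℝ) + 1) / 2 ≤ (ℓ : ℝ) + 1 - k := by nlinarith [sq_nonneg ((k : ℝ) - 1)]
        have h5 : (0 : ℝ) < κ / 2 * 2 ^ (-α) * ((ℓ : ℝ) + 1) ^ (α - 1) := by positivity
        have h6 := mul_le_mul_of_nonneg_right h4 h5.le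
        rw [e]
        linarith
      have := term_le_of_sq_lt hα hκ h h2 (h3 k) hd'
      linarith
  rw [← Finset.sum_filter_add_sum_filter_not s (fun k => k ≤ m)]
  have s1 : ∑ k ∈ s with k ≤ m, (c k * (k : ℝ) ^ (α - 1) / ‖z - t k‖) ^ 2 ≤ 1 / 16 := by
    refine (Finset.sum_le_sum fun k hk => hleft k (Finset.mem_filter.1 hk).2).trans ?_
    rw [← Finset.mul_sum, Finset.sum_add_distrib]
    have a1 := sum_inv_sq_le_le (s.filter fun k => k ≤ m) m
      fun k hk => (Finset.mem_filter.1 hk).2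
    have a2 := sum_inv_sq_pnat_le (s.filter fun k => k ≤ m)
    linarith
  have s2 : ∑ k ∈ s with ¬ k ≤ m, (c k * (k : ℝ) ^ (α - 1) / ‖z - t k‖) ^ 2 ≤ 1 / 32 := by
    refine (Finset.sum_le_sum fun k hk => hright k (not_le.1 (Finset.mem_filter.1 hk).2)).trans ?_
    rw [← Finset.mul_sum]
    have a1 := sum_inv_sq_gt_le (s.filter fun k => ¬ k ≤ m) m
      fun k hk => not_le.1 (Finset.mem_filter.1 hk).2
    linarith
  linarith

/-- The sum that controls `B (z - T)⁻¹`, outside of the open boxes. -/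
theorem sum_le_of_notMem (hα : 0 < α) (hκ : 0 < κ)
    (hgap : ∀ k : ℕ+, κ * (k : ℝ) ^ (α - 1) ≤ t (k + 1) - t k) {V : ℝ} {ℓ : ℕ+}
    (h1 : ∀ k, threshold α * c k ^ 2 ≤ κ ^ 2 ∨ (k : ℝ) ^ 2 < V) (h2 : V ≤ ℓ + 1)
    (h3 : ∀ k, threshold α * c k ^ 2 ≤ κ ^ 2 * V ^ α) {M Y : ℝ} (hM : ∀ k, c k ^ 2 ≤ M)
    (hY : 0 < Y)
    (hYM : 4 * M * ∑ k ∈ Finset.Icc 1 ℓ, (k : ℝ) ^ (2 * (α - 1)) ≤ Y ^ 2) {z : ℂ}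
    (hbig : z ∉ openBox (min 0 (t 1) - Y) (rightEnd α κ t ℓ) Y)
    (hsmall : ∀ j, ℓ < j →
      z ∉ openBox (leftEnd α κ t j) (rightEnd α κ t j) (halfHeight α κ j)) (s : Finset ℕ+) :
    ∑ k ∈ s, (c k * (k : ℝ) ^ (α - 1) / ‖z - t k‖) ^ 2 ≤ 1 / 2 := by
  by_cases hz : rightEnd α κ t ℓ ≤ z.re
  · exact sum_le_of_right hα hκ hgap h1 h2 h3 hz hsmall s
  rw [not_le] at hz
  have hx : ∀ j : ℕ+, 0 < (j : ℝ) ^ (α - 1) := fun j => pnat_rpow_pos j _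
  -- Now z is left of the right end but outside the big box, so it is above, below or to the left of
  -- it; all t_k are real and at least t_1.
  have hnorm : ∀ k, Y ≤ ‖z - t k‖ := by
    intro k
    by_cases hre : min 0 (t 1) - Y < z.re
    · have : Y ≤ |z.im| := by
        by_contra! h
        exact hbig ⟨hre, hz, h⟩
      exact this.trans (abs_im_le_norm_sub z _)
    · refine le_trans ?_ (abs_re_sub_le_norm z _)
      rw [abs_sub_comm]
      refine le_trans ?_ (le_abs_self _)
      have a1 := min_le_right 0 (t 1)
      have a2 := (strictMono_of_gap hκ hgap).monotone (one_le (a := k))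
      linarith
  have hgood : ∀ k, ℓ < k → threshold α * c k ^ 2 ≤ κ ^ 2 := by
    intro k hk
    refine (h1 k).resolve_right fun h => ?_
    have hk' : (ℓ : ℝ) + 1 ≤ k := by
      have : (ℓ : ℕ) < k := hk
      exact_mod_cast this
    have : (1 : ℝ) ≤ k := by exact_mod_cast k.pos
    nlinarith
  rw [← Finset.sum_filter_add_sum_filter_not s (fun k => k ≤ ℓ)]
  have s1 : ∑ k ∈ s with k ≤ ℓ, (c k * (k : ℝ) ^ (α - 1) / ‖z - t k‖) ^ 2 ≤ 1 / 4 := by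
    have b1 : ∀ k : ℕ+, (c k * (k : ℝ) ^ (α - 1) / ‖z - t k‖) ^ 2 ≤
        M / Y ^ 2 * (k : ℝ) ^ (2 * (α - 1)) := by
      intro k
      have e : (k : ℝ) ^ (2 * (α - 1)) = ((k : ℝ) ^ (α - 1)) ^ 2 := by
        rw [← Real.rpow_natCast, ← Real.rpow_mul (by positivity), mul_comm]
        norm_num
      have hn := hnorm k
      rw [e, div_pow, mul_pow]
      calc c k ^ 2 * ((k : ℝ) ^ (α - 1)) ^ 2 / ‖z - t k‖ ^ 2
          ≤ c k ^ 2 * ((k : ℝ) ^ (α - 1)) ^ 2 / Y ^ 2 := by gcongr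
        _ ≤ M * ((k : ℝ) ^ (α - 1)) ^ 2 / Y ^ 2 := by gcongr; exact hM k
        _ = _ := by ring
    have b2 : (s.filter fun k => k ≤ ℓ) ⊆ Finset.Icc 1 ℓ := fun k hk =>
      Finset.mem_Icc.2 ⟨one_le, (Finset.mem_filter.1 hk).2⟩
    calc _ ≤ ∑ k ∈ Finset.Icc 1 ℓ, (c k * (k : ℝ) ^ (α - 1) / ‖z - t k‖) ^ 2 :=
          Finset.sum_le_sum_of_subset_of_nonneg b2 fun _ _ _ => sq_nonneg _
      _ ≤ ∑ k ∈ Finset.Icc 1 ℓ, M / Y ^ 2 * (k : ℝ) ^ (2 * (α - 1)) :=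
          Finset.sum_le_sum fun k _ => b1 k
      _ ≤ 1 / 4 := by
          rw [← Finset.mul_sum, div_mul_eq_mul_div, div_le_iff₀ (by positivity)]
          linarith
  have s2 : ∑ k ∈ s with ¬ k ≤ ℓ, (c k * (k : ℝ) ^ (α - 1) / ‖z - t k‖) ^ 2 ≤ 1 / 32 := by
    -- For k > ℓ the distance is measured from the right end of the big box, whatever the imaginary
    -- part of z.
    have hright : ∀ k, ℓ < k → (c k * (k : ℝ) ^ (α - 1) / ‖z - t k‖) ^ 2 ≤
        1 / 64 * (((k : ℝ) - ℓ) ^ 2)⁻¹ := by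
      intro k hk
      have hk' : (ℓ : ℝ) < k := by exact_mod_cast hk
      refine term_le_of_threshold hα hκ (hgood k hk) (hx k) (sub_pos.2 hk') ?_
      have hd := sub_rightEnd_ge hα hκ hgap hk
      have hd' : t k - rightEnd α κ t ℓ ≤ ‖z - t k‖ := by
        refine le_trans ?_ (abs_re_sub_le_norm z _)
        rw [abs_sub_comm]
        exact le_trans (by linarith) (le_abs_self _)
      refine le_trans ?_ (hd.trans hd')
      have := hx k
      have := sub_pos.2 hk'
      gcongr
      norm_num
    refine (Finset.sum_le_sum fun k hk => hright k (not_le.1 (Finset.mem_filter.1 hk).2)).trans ?_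
    rw [← Finset.mul_sum]
    have a1 := sum_inv_sq_gt_le (s.filter fun k => ¬ k ≤ ℓ) ℓ
      fun k hk => not_le.1 (Finset.mem_filter.1 hk).2
    linarith
  linarith

end localization

/-! ### The blocks V_J and condition (*). -/

section blocks

variable {α κ : ℝ} {c : ℕ+ → ℝ} {N : ℕ} {ℓ : ℕ+}

theorem one_lt_ratio (hα1 : α ≠ 1) : 1 < ratio α :=
  Real.one_lt_rpow (by norm_num) (one_div_pos.2 (abs_pos.2 (sub_ne_zero.2 hα1)))

theorem exists_mem_block (hα1 : α ≠ 1) (k : ℕ+) : ∃ J, k ∈ block α J :=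
  exists_nat_pow_near (by exact_mod_cast k.pos) (one_lt_ratio hα1)

theorem lt_of_mem_block (hα1 : α ≠ 1) {k : ℕ+} {J : ℕ} (hJ : J ≤ N) (hk : k ∈ block α J) :
    (k : ℝ) < ratio α ^ (N + 1) :=
  hk.2.trans_le (pow_le_pow_right₀ (one_lt_ratio hα1).le (by omega))

theorem exists_isGreatest_block (hα1 : α ≠ 1) (N : ℕ) :
    ∃ ℓ : ℕ+, IsGreatest (⋃ J ∈ Set.Iic N, block α J) ℓ := by
  obtain ⟨M, hM⟩ := exists_nat_gt (ratio α ^ (N + 1))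
  have hM0 : 0 < M := by
    have : (0 : ℝ) < M := (pow_pos (zero_lt_one.trans (one_lt_ratio hα1)) _).trans hM
    exact_mod_cast this
  lift M to ℕ+ using hM0
  have hfin : (⋃ J ∈ Set.Iic N, block α J).Finite := by
    refine (Set.finite_Iic M).subset fun k hk => ?_
    simp only [Set.mem_iUnion, Set.mem_Iic] at hk
    obtain ⟨J, hJ, hkJ⟩ := hk
    have := (lt_of_mem_block hα1 hJ hkJ).trans hM
    exact (by exact_mod_cast this : k < M).le
  have hne : (⋃ J ∈ Set.Iic N, block α J).Nonempty := by
    refine ⟨1, ?_⟩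
    simp only [Set.mem_iUnion, Set.mem_Iic]
    refine ⟨0, Nat.zero_le _, ?_⟩
    simpa [block] using one_lt_ratio hα1
  obtain ⟨ℓ, hℓ, hmax⟩ := Set.exists_max_image _ id hfin hne
  exact ⟨ℓ, hℓ, fun k hk => hmax k hk⟩

/-- By maximality of ℓ, the block containing ℓ + 1 has index at least N + 1. -/
theorem ratio_pow_le (hα1 : α ≠ 1) (hℓ : IsGreatest (⋃ J ∈ Set.Iic N, block α J) ℓ) :
    ratio α ^ (N + 1) ≤ (ℓ : ℝ) + 1 := by
  by_contra! h
  obtain ⟨J, hJ⟩ := exists_mem_block hα1 (ℓ + 1)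
  have hJN : J ≤ N := by
    by_contra! hN
    have h1 : ratio α ^ (N + 1) ≤ ratio α ^ J := pow_le_pow_right₀ (one_lt_ratio hα1).le hN
    have h2 := hJ.1
    push_cast at h2
    linarith
  have := hℓ.2 (Set.mem_biUnion (x := J) hJN hJ)
  exact absurd this (not_le.2 (PNat.lt_add_right ℓ 1))

theorem threshold_pos (hα : 0 < α) : 0 < threshold α := by
  unfold threshold
  positivity

/-- Needed for c_∞ to be a true upper bound: the real supremum of an unbounded family defaults to 0.
-/
theorem bddAbove_range_abs (hc : Tendsto c atTop (𝓝 0)) : BddAbove (Set.range fun k => |c k|) := by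
  have h1 : ∀ᶠ k in atTop, |c k| ≤ 1 := by
    have := hc.abs
    rw [abs_zero] at this
    exact this.eventually_le_const zero_lt_one
  obtain ⟨k₀, hk₀⟩ := eventually_atTop.1 h1
  obtain ⟨M, hM⟩ := ((Set.finite_Iic k₀).image fun k => |c k|).bddAbove
  refine ⟨max M 1, ?_⟩
  rintro _ ⟨k, rfl⟩
  rcases le_total k k₀ with h | h
  · exact (hM ⟨k, h, rfl⟩).trans (le_max_left _ _)
  · exact (hk₀ k h).trans (le_max_right _ _)

theorem sq_le_iSup_sq (hc : Tendsto c atTop (𝓝 0)) (k : ℕ+) : c k ^ 2 ≤ (⨆ k, |c k|) ^ 2 := by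
  rw [← sq_abs]
  have := le_ciSup (bddAbove_range_abs hc) k
  gcongr

/-- If k lies in V_J with 2J < N, then 2(J + 1) ≤ N + 1, so k² < v^(2(J+1)) ≤ v^(N+1). The range J ≥
N/2 in (*) is what makes k² appear. -/
theorem IsLargeEnough.threshold_le_or (hα1 : α ≠ 1) (h : IsLargeEnough α κ c N) (k : ℕ+) :
    threshold α * c k ^ 2 ≤ κ ^ 2 ∨ (k : ℝ) ^ 2 < ratio α ^ (N + 1) := by
  obtain ⟨J, hJ⟩ := exists_mem_block hα1 k
  by_cases hJN : (N : ℝ) / 2 ≤ J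
  · exact Or.inl (h.2 J hJN k hJ)
  · right
    have hJN' : 2 * J < N := by
      have : 2 * (J : ℝ) < N := by linarith
      exact_mod_cast this
    calc (k : ℝ) ^ 2 < (ratio α ^ (J + 1)) ^ 2 := by
          have := hJ.2
          gcongr
      _ = ratio α ^ ((J + 1) * 2) := (pow_mul _ _ _).symm
      _ ≤ ratio α ^ (N + 1) := pow_le_pow_right₀ (one_lt_ratio hα1).le (by omega)

theorem IsLargeEnough.threshold_le (hα : 0 < α) (hα1 : α ≠ 1) (hc : Tendsto c atTop (𝓝 0))
    (h : IsLargeEnough α κ c N) (k : ℕ+) :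
    threshold α * c k ^ 2 ≤ κ ^ 2 * (ratio α ^ (N + 1)) ^ α := by
  have hv := one_lt_ratio hα1
  calc threshold α * c k ^ 2 ≤ threshold α * (⨆ k, |c k|) ^ 2 :=
        mul_le_mul_of_nonneg_left (sq_le_iSup_sq hc k) (threshold_pos hα).le
    _ ≤ κ ^ 2 * ratio α ^ (α * (N : ℝ)) := h.1.le
    _ ≤ κ ^ 2 * ratio α ^ (((N + 1 : ℕ) : ℝ) * α) := by
        refine mul_le_mul_of_nonneg_left (Real.rpow_le_rpow_of_exponent_le hv.le ?_) (sq_nonneg _)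
        push_cast
        linarith
    _ = _ := by rw [Real.rpow_mul (by linarith), Real.rpow_natCast]

theorem eventually_isLargeEnough (hα : 0 < α) (hα1 : α ≠ 1) (hκ : 0 < κ)
    (hc : Tendsto c atTop (𝓝 0)) : ∀ᶠ N in atTop, IsLargeEnough α κ c N := by
  have hv := one_lt_ratio hα1
  have h1 : Tendsto (fun N : ℕ => κ ^ 2 * ratio α ^ (α * (N : ℝ))) atTop atTop := by
    refine Tendsto.const_mul_atTop (by positivity) ?_
    have : (fun N : ℕ => ratio α ^ (α * (N : ℝ))) = fun N : ℕ => (ratio α ^ α) ^ N := by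
      ext N
      rw [Real.rpow_mul (by linarith), Real.rpow_natCast]
    rw [this]
    exact tendsto_pow_atTop_atTop_of_one_lt (Real.one_lt_rpow hv hα)
  have h2 : ∀ᶠ k in atTop, threshold α * c k ^ 2 ≤ κ ^ 2 := by
    have h3 : Tendsto (fun k => threshold α * c k ^ 2) atTop (𝓝 (threshold α * 0 ^ 2)) :=
      (hc.pow 2).const_mul _
    rw [zero_pow two_ne_zero, mul_zero] at h3
    exact h3.eventually_le_const (by positivity)
  obtain ⟨k₀, hk₀⟩ := eventually_atTop.1 h2
  -- Once v^J ≥ k₀, every member of V_J is at least k₀; J ≥ N/2 with N ≥ 2 J₀ ensures this.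
  obtain ⟨J₀, hJ₀⟩ := eventually_atTop.1
    ((tendsto_pow_atTop_atTop_of_one_lt hv).eventually_ge_atTop (k₀ : ℝ))
  filter_upwards [h1.eventually_gt_atTop (threshold α * (⨆ k, |c k|) ^ 2),
    eventually_ge_atTop (2 * J₀)] with N hN hN'
  refine ⟨hN, fun J hJ j hj => hk₀ j ?_⟩
  have hJ' : J₀ ≤ J := by
    have : (2 * J₀ : ℝ) ≤ N := by exact_mod_cast hN'
    have : (J₀ : ℝ) ≤ J := by linarith
    exact_mod_cast this
  exact_mod_cast (hJ₀ J hJ').trans hj.1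

end blocks

/-! ### Relative position of the boxes and the eigenvalues t_k. -/

section boxes

variable {α κ : ℝ} {t : ℕ+ → ℝ}

theorem lt_rightEnd (hκ : 0 < κ) (k : ℕ+) : t k < rightEnd α κ t k := by
  have := mul_pos (half_pos hκ) (pnat_rpow_pos k (α - 1))
  unfold rightEnd
  linarith

theorem leftEnd_lt (hκ : 0 < κ) (k : ℕ+) : leftEnd α κ t k < t k := by
  have : 0 < κ / 2 * (max ((k : ℝ) - 1) 1) ^ (α - 1) := by positivity
  unfold leftEnd
  linarith

theorem halfHeight_pos (hκ : 0 < κ) (k : ℕ+) : 0 < halfHeight α κ k :=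
  mul_pos (half_pos hκ) (pnat_rpow_pos k (α - 1))

theorem leftEnd_add_one (k : ℕ+) :
    leftEnd α κ t (k + 1) = t (k + 1) - κ / 2 * (k : ℝ) ^ (α - 1) := by
  have hk : (1 : ℝ) ≤ k := by exact_mod_cast k.pos
  unfold leftEnd
  congr 3
  simp [hk]

/-- The boxes of n and n + 1 each take (κ/2) n^(α-1) of the gap between t_n and t_(n+1). They may
touch, but do not overlap. -/
theorem rightEnd_le_leftEnd (hκ : 0 < κ)
    (hgap : ∀ k : ℕ+, κ * (k : ℝ) ^ (α - 1) ≤ t (k + 1) - t k) {i j : ℕ+} (hij : i < j) :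
    rightEnd α κ t i ≤ leftEnd α κ t j := by
  have key : ∀ n, rightEnd α κ t n ≤ leftEnd α κ t (n + 1) := by
    intro n
    rw [leftEnd_add_one, rightEnd]
    have := hgap n
    linarith
  obtain ⟨n, rfl⟩ := PNat.exists_eq_succ_of_ne_one (one_le.trans_lt hij).ne'
  rcases (PNat.lt_add_one_iff.1 hij).eq_or_lt with rfl | h
  · exact key _
  · have h1 := (key i).trans (leftEnd_lt hκ _).le
    have h2 := (strictMono_of_gap hκ hgap).monotone (PNat.add_one_le_iff.2 h)
    exact h1.trans (h2.trans ((lt_rightEnd hκ n).le.trans (key n)))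

theorem mem_openBox_small (hκ : 0 < κ) (k : ℕ+) :
    (t k : ℂ) ∈ openBox (leftEnd α κ t k) (rightEnd α κ t k) (halfHeight α κ k) :=
  ⟨by simpa using leftEnd_lt hκ k, by simpa using lt_rightEnd hκ k,
    by simpa using halfHeight_pos hκ k⟩

theorem notMem_smallBox (hκ : 0 < κ)
    (hgap : ∀ k : ℕ+, κ * (k : ℝ) ^ (α - 1) ≤ t (k + 1) - t k) {j k : ℕ+} (hjk : k ≠ j) :
    (t k : ℂ) ∉ box (leftEnd α κ t j) (rightEnd α κ t j) (halfHeight α κ j) := by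
  rintro ⟨h1, h2, -⟩
  simp only [Complex.ofReal_re] at h1 h2
  rcases lt_or_gt_of_ne hjk with h | h
  · have := rightEnd_le_leftEnd hκ hgap h
    have := lt_rightEnd (α := α) (t := t) hκ k
    linarith
  · have := rightEnd_le_leftEnd hκ hgap h
    have := leftEnd_lt (α := α) (t := t) hκ k
    linarith

variable {Y : ℝ} {ℓ : ℕ+}

theorem mem_openBox_big (hκ : 0 < κ)
    (hgap : ∀ k : ℕ+, κ * (k : ℝ) ^ (α - 1) ≤ t (k + 1) - t k) (hY : 0 < Y) {k : ℕ+} (hk : k ≤ ℓ) :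
    (t k : ℂ) ∈ openBox (min 0 (t 1) - Y) (rightEnd α κ t ℓ) Y := by
  have hmono := (strictMono_of_gap hκ hgap).monotone
  have h1 := hmono (one_le (a := k))
  have h2 := hmono hk
  have h3 := lt_rightEnd (α := α) (t := t) hκ ℓ
  have h4 := min_le_right 0 (t 1)
  refine ⟨?_, ?_, by simpa using hY⟩ <;> simp only [Complex.ofReal_re] <;> linarith

theorem notMem_bigBox (hκ : 0 < κ)
    (hgap : ∀ k : ℕ+, κ * (k : ℝ) ^ (α - 1) ≤ t (k + 1) - t k) {k : ℕ+} (hk : ℓ < k) :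
    (t k : ℂ) ∉ box (min 0 (t 1) - Y) (rightEnd α κ t ℓ) Y := by
  rintro ⟨-, h2, -⟩
  have := rightEnd_le_leftEnd hκ hgap hk
  have := leftEnd_lt (α := α) (t := t) hκ k
  simp only [Complex.ofReal_re] at h2
  linarith

/-- The complement of the open boxes. -/
def outside (α κ : ℝ) (t : ℕ+ → ℝ) (ℓ : ℕ+) (Y : ℝ) : Set ℂ :=
  {z | z ∉ openBox (min 0 (t 1) - Y) (rightEnd α κ t ℓ) Y ∧ ∀ j, ℓ < j →
    z ∉ openBox (leftEnd α κ t j) (rightEnd α κ t j) (halfHeight α κ j)}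

/-- Touching boxes can share boundary points, so `outside` omits only open boxes; each contour then
avoids the interior of every box. -/
theorem frontier_bigBox_subset (hκ : 0 < κ)
    (hgap : ∀ k : ℕ+, κ * (k : ℝ) ^ (α - 1) ≤ t (k + 1) - t k) :
    frontier (box (min 0 (t 1) - Y) (rightEnd α κ t ℓ) Y) ⊆ outside α κ t ℓ Y := by
  intro z hz
  rw [frontier_box] at hz
  refine ⟨hz.2, fun j hj h => ?_⟩
  have h1 := rightEnd_le_leftEnd hκ hgap hj
  have h2 := hz.1.2.1
  have h3 := h.1
  linarith

theorem frontier_smallBox_subset (hκ : 0 < κ)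
    (hgap : ∀ k : ℕ+, κ * (k : ℝ) ^ (α - 1) ≤ t (k + 1) - t k) {j : ℕ+} (hj : ℓ < j) :
    frontier (box (leftEnd α κ t j) (rightEnd α κ t j) (halfHeight α κ j)) ⊆
      outside α κ t ℓ Y := by
  intro z hz
  rw [frontier_box] at hz
  refine ⟨fun h => ?_, fun i hi h => ?_⟩
  · have h1 := rightEnd_le_leftEnd hκ hgap hj
    have h2 := hz.1.1
    have h3 := h.2.1
    linarith
  · rcases lt_trichotomy i j with hij | rfl | hij
    · have h1 := rightEnd_le_leftEnd hκ hgap hij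
      have h2 := hz.1.1
      have h3 := h.2.1
      linarith
    · exact hz.2 h
    · have h1 := rightEnd_le_leftEnd hκ hgap hij
      have h2 := hz.1.2.1
      have h3 := h.1
      linarith

end boxes

/-! ### Localization, discreteness and eventual simplicity. -/

section conclusion

variable {H : Type*} [NormedAddCommGroup H] [InnerProductSpace ℂ H]

theorem finiteDimensional_range_of_opDim {Q : H →L[ℂ] H} {n : ℕ} (h : opDim Q = n) :
    FiniteDimensional ℂ (LinearMap.range (Q : H →ₗ[ℂ] H)) :=
  Module.rank_lt_aleph0_iff.1 (lt_of_eq_of_lt h (Cardinal.natCast_lt_aleph0 (n := n)))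

theorem frontier_smallBox_subset_resolventSet {T : H →ₗ.[ℂ] H} {α κ : ℝ}
    {t : ℕ+ → ℝ} (hκ : 0 < κ)
    (hT : opSpectrum T = Set.range fun k => (t k : ℂ))
    (hgap : ∀ k : ℕ+, κ * (k : ℝ) ^ (α - 1) ≤ t (k + 1) - t k) (j : ℕ+) :
    frontier (box (leftEnd α κ t j) (rightEnd α κ t j) (halfHeight α κ j)) ⊆ resolventSet T := by
  intro z hz
  rw [frontier_box] at hz
  rw [mem_resolventSet_iff, hT]
  rintro ⟨k, rfl⟩
  by_cases hkj : k = j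
  · subst hkj
    exact hz.2 (mem_openBox_small hκ k)
  · exact notMem_smallBox hκ hgap hkj hz.1

variable [CompleteSpace H]

theorem exists_isolating_radius {A : H →ₗ.[ℂ] H} {z : ℂ} (hz : z ∈ resolventSet A) :
    ∃ r : ℝ, 0 < r ∧ opSpectrum A ∩ Metric.closedBall z r ⊆ {z} := by
  obtain ⟨r, hr, hball⟩ := Metric.nhds_basis_closedBall.mem_iff.1
    ((isOpen_resolventSet A).mem_nhds hz)
  exact ⟨r, hr, fun w hw => absurd hw.1 (mem_resolventSet_iff.1 (hball hw.2))⟩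

/-- If the spectrum lies inside of contours that avoid it, one with a Riesz projection of finite
rank and the others with Riesz projections of rank one, then the spectrum is discrete and
eventually simple. -/
theorem discrete_and_simple_of_boxes {ι : Type*} {A : H →ₗ.[ℂ] H} {a₁ a₂ b : ℝ}
    {l r h : ι → ℝ} {n : ℕ} (ha : a₁ ≤ a₂) (hb : 0 ≤ b) (hlr : ∀ j, l j ≤ r j) (hh : ∀ j, 0 ≤ h j)
    (hcover : ∀ w ∈ opSpectrum A, w ∈ openBox a₁ a₂ b ∨ ∃ j, w ∈ openBox (l j) (r j) (h j))
    (hA : frontier (box a₁ a₂ b) ⊆ resolventSet A)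
    (hAj : ∀ j, frontier (box (l j) (r j) (h j)) ⊆ resolventSet A)
    (hn : opDim (boxProjection A a₁ a₂ b) = n)
    (h1 : ∀ j, opDim (boxProjection A (l j) (r j) (h j)) = 1) :
    HasDiscreteSpectrum A ∧ HasEventuallySimpleSpectrum A := by
  have hfd := finiteDimensional_range_of_opDim hn
  have hfdj : ∀ j, FiniteDimensional ℂ
      (LinearMap.range (boxProjection A (l j) (r j) (h j) : H →ₗ[ℂ] H)) := fun j =>
    finiteDimensional_range_of_opDim (n := 1) (by rw [h1 j, Nat.cast_one])
  refine ⟨⟨fun z => ?_, fun w hw => ?_⟩, ?_⟩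
  · by_cases hz : z ∈ opSpectrum A
    · rcases hcover z hz with hz' | ⟨j, hz'⟩
      · obtain ⟨r, hr, -, hsp⟩ := exists_radius_of_mem_openBox ha hb hA hz'
        exact ⟨r, hr, hsp⟩
      · obtain ⟨r, hr, -, hsp⟩ := exists_radius_of_mem_openBox (hlr j) (hh j) (hAj j) hz'
        exact ⟨r, hr, hsp⟩
    · exact exists_isolating_radius (mem_resolventSet_iff.2 hz)
  · rcases hcover w hw with hw' | ⟨j, hw'⟩
    · obtain ⟨x, hx0, hx, -⟩ := exists_eigenvector_of_mem_openBox ha hb hA hw' hw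
      exact ⟨⟨x, hx0, hx⟩, exists_hasAlgMultiplicity ha hb hA hw'⟩
    · obtain ⟨x, hx0, hx, -⟩ := exists_eigenvector_of_mem_openBox (hlr j) (hh j) (hAj j) hw' hw
      exact ⟨⟨x, hx0, hx⟩, exists_hasAlgMultiplicity (hlr j) (hh j) (hAj j) hw'⟩
  -- Points in the rank-one boxes are simple, so the exceptions lie in the first box, which holds
  -- finitely many spectral points.
  · refine (finite_spectrum_inter_openBox ha hb hA).subset ?_
    rintro w ⟨hw, hm⟩
    refine ⟨hw, (hcover w hw).resolve_right ?_⟩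
    rintro ⟨j, hj⟩
    exact hm (hasAlgMultiplicity_one (hlr j) (hh j) (hAj j) (h1 j) hj hw)

variable {α κ : ℝ} {T B : H →ₗ.[ℂ] H} {t c : ℕ+ → ℝ}

theorem opDim_smallProjection (hκ : 0 < κ) (φ : HilbertBasis ℕ+ ℂ H)
    (hφ : ∀ k, φ k ∈ T.domain) (hTφ : ∀ k, T ⟨φ k, hφ k⟩ = (t k : ℂ) • φ k)
    (hT : opSpectrum T = Set.range fun k => (t k : ℂ))
    (hgap : ∀ k : ℕ+, κ * (k : ℝ) ^ (α - 1) ≤ t (k + 1) - t k) (j : ℕ+) :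
    opDim (smallProjection T α κ t j) = 1 := by
  have := opDim_boxProjection_diagonal φ (fun k => (t k : ℂ)) hφ hTφ
    ((leftEnd_lt hκ j).trans (lt_rightEnd hκ j)).le (halfHeight_pos hκ j).le
    (frontier_smallBox_subset_resolventSet hκ hT hgap j) {j}
    (fun k hk => by rw [Finset.mem_singleton.1 hk]; exact mem_openBox_small hκ j)
    (fun k hk => notMem_smallBox hκ hgap (by simpa using hk))
  rwa [Finset.card_singleton, Nat.cast_one] at this

/-- The localization of the spectrum of `T + B`, with the ranks of the Riesz projections. -/
theorem localization (hα : 0 < α) (hα1 : α ≠ 1) (hκ : 0 < κ) (φ : HilbertBasis ℕ+ ℂ H)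
    (hφ : ∀ k, φ k ∈ T.domain) (hTφ : ∀ k, T ⟨φ k, hφ k⟩ = (t k : ℂ) • φ k)
    (hT : opSpectrum T = Set.range fun k => (t k : ℂ))
    (hgap : ∀ k : ℕ+, κ * (k : ℝ) ^ (α - 1) ≤ t (k + 1) - t k)
    (hB : B.IsClosed) (hTB : T.domain ≤ B.domain)
    (hBφ : ∀ k : ℕ+, ‖B ⟨φ k, hTB (hφ k)⟩‖ = c k * (k : ℝ) ^ (α - 1))
    (hc : Tendsto c atTop (𝓝 0)) {N : ℕ} (hN : IsLargeEnough α κ c N) {ℓ : ℕ+}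
    (hℓ : IsGreatest (⋃ J ∈ Set.Iic N, block α J) ℓ) {Y : ℝ} (hY : 0 < Y)
    (hYc : 4 * (⨆ k, |c k|) ^ 2 * ∑ k ∈ Finset.Icc 1 ℓ, (k : ℝ) ^ (2 * (α - 1)) ≤ Y ^ 2) :
    outside α κ t ℓ Y ⊆ resolventSet (T + B) ∧
      opDim (bigProjection (T + B) α κ t ℓ Y) = (Finset.Icc 1 ℓ).card ∧
      ∀ j, ℓ < j → opDim (smallProjection (T + B) α κ t j) = 1 := by
  have hTout : outside α κ t ℓ Y ⊆ resolventSet T := by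
    intro z hz
    rw [mem_resolventSet_iff, hT]
    rintro ⟨k, rfl⟩
    rcases le_or_gt k ℓ with hk | hk
    · exact hz.1 (mem_openBox_big hκ hgap hY hk)
    · exact hz.2 k hk (mem_openBox_small hκ k)
  -- The contraction constant is the square root of the bound 1/2 in `sum_le_of_notMem`.
  have hq0 : 0 ≤ Real.sqrt (1 / 2) := Real.sqrt_nonneg _
  have hq1 : Real.sqrt (1 / 2) < 1 := by
    rw [Real.sqrt_lt' one_pos]
    norm_num
  have hK : ∀ z ∈ outside α κ t ℓ Y, ∃ K : H →L[ℂ] H, ‖K‖ ≤ Real.sqrt (1 / 2) ∧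
      ∀ (y : H) (h : opResolvent T z y ∈ T.domain), K y = B ⟨opResolvent T z y, hTB h⟩ := by
    intro z hz
    refine exists_bounded_comp_resolvent hTB hB φ (fun k => (t k : ℂ)) hφ hTφ
      (isResolventAt_opResolvent (hTout hz)) hq0 fun s => ?_
    rw [Real.sq_sqrt (by norm_num)]
    simp only [hBφ]
    exact sum_le_of_notMem hα hκ hgap (hN.threshold_le_or hα1) (ratio_pow_le hα1 hℓ)
      (hN.threshold_le hα hα1 hc) (sq_le_iSup_sq hc) hY hYc hz.1 hz.2 s
  have hbig := frontier_bigBox_subset (Y := Y) (ℓ := ℓ) hκ hgap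
  have hmem1 := mem_openBox_big (Y := Y) hκ hgap hY (le_refl ℓ)
  refine ⟨fun z hz => mem_resolventSet_add hTB (hTout hz) hq1 (hK z hz), ?_, ?_⟩
  · have ha := (hmem1.1.trans hmem1.2.1).le
    refine (opDim_boxProjection_add hTB ha hY.le (hbig.trans hTout) hq0 hq1
      fun z hz => hK z (hbig hz)).trans ?_
    refine opDim_boxProjection_diagonal φ (fun k => (t k : ℂ)) hφ hTφ ha hY.le
      (hbig.trans hTout) (Finset.Icc 1 ℓ) (fun k hk => ?_) fun k hk => ?_
    · exact mem_openBox_big hκ hgap hY (Finset.mem_Icc.1 hk).2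
    · refine notMem_bigBox hκ hgap ?_
      by_contra! h
      exact hk (Finset.mem_Icc.2 ⟨one_le, h⟩)
  · intro j hj
    have hsmall := frontier_smallBox_subset (Y := Y) hκ hgap hj
    refine (opDim_boxProjection_add hTB ((leftEnd_lt hκ j).trans (lt_rightEnd hκ j)).le
      (halfHeight_pos hκ j).le (hsmall.trans hTout) hq0 hq1 fun z hz => hK z (hsmall hz)).trans ?_
    exact opDim_smallProjection hκ φ hφ hTφ hT hgap j

end conclusion

end PerturbedOperator

end

theorem mainTheorem6 {H : Type*} [NormedAddCommGroup H] [InnerProductSpace ℂ H] [CompleteSpace H]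
    (α κ : ℝ) (hα : 0 < α) (hα1 : α ≠ 1) (hκ : 0 < κ)
    (T B : H →ₗ.[ℂ] H) (φ : HilbertBasis ℕ+ ℂ H) (t c : ℕ+ → ℝ)
    (hφ : ∀ k, φ k ∈ T.domain)
    (hTφ : ∀ k, T ⟨φ k, hφ k⟩ = (t k : ℂ) • φ k)
    (hT : PerturbedOperator.opSpectrum T = Set.range fun k => (t k : ℂ))
    (hgap : ∀ k : ℕ+, κ * (k : ℝ) ^ (α - 1) ≤ t (k + 1) - t k)
    (hB : B.IsClosed) (hTB : T.domain ≤ B.domain)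
    (hBφ : ∀ k : ℕ+, ‖B ⟨φ k, hTB (hφ k)⟩‖ = c k * (k : ℝ) ^ (α - 1))
    (hc : Filter.Tendsto c Filter.atTop (nhds 0)) :
    PerturbedOperator.HasDiscreteSpectrum (T + B) ∧
    PerturbedOperator.HasEventuallySimpleSpectrum (T + B) ∧
    (∀ᶠ N in Filter.atTop, PerturbedOperator.IsLargeEnough α κ c N) ∧
    ∀ N : ℕ, PerturbedOperator.IsLargeEnough α κ c N →
      ∀ ℓ : ℕ+, IsGreatest (⋃ J ∈ Set.Iic N, PerturbedOperator.block α J) ℓ →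
      ∀ Y : ℝ, 0 < Y →
        4 * (⨆ k, |c k|) ^ 2 * ∑ k ∈ Finset.Icc 1 ℓ, (k : ℝ) ^ (2 * (α - 1)) ≤ Y ^ 2 →
        PerturbedOperator.opSpectrum (T + B) ⊆
          PerturbedOperator.bigBox α κ t ℓ Y ∪
            ⋃ j ∈ Set.Ioi ℓ, PerturbedOperator.smallBox α κ t j ∧
        -- no contour meets the relevant spectrum
        (Disjoint (frontier (PerturbedOperator.bigBox α κ t ℓ Y))
            (PerturbedOperator.opSpectrum (T + B)) ∧
          (∀ j, ℓ < j → Disjoint (frontier (PerturbedOperator.smallBox α κ t j))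
            (PerturbedOperator.opSpectrum (T + B))) ∧
          ∀ j, Disjoint (frontier (PerturbedOperator.smallBox α κ t j))
            (PerturbedOperator.opSpectrum T)) ∧
        PerturbedOperator.opDim (PerturbedOperator.bigProjection (T + B) α κ t ℓ Y) =
          ∑ j ∈ Finset.Icc 1 ℓ,
            PerturbedOperator.opDim (PerturbedOperator.smallProjection T α κ t j) ∧
        ∀ j, ℓ < j →
          PerturbedOperator.opDim (PerturbedOperator.smallProjection (T + B) α κ t j) =
              PerturbedOperator.opDim (PerturbedOperator.smallProjection T α κ t j) ∧
            PerturbedOperator.opDim (PerturbedOperator.smallProjection T α κ t j) = 1 := by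
  have hloc := fun (N : ℕ) (hN : PerturbedOperator.IsLargeEnough α κ c N) (ℓ : ℕ+)
    (hℓ : IsGreatest (⋃ J ∈ Set.Iic N, PerturbedOperator.block α J) ℓ) (Y : ℝ) (hY : 0 < Y)
    (hYc : 4 * (⨆ k, |c k|) ^ 2 * ∑ k ∈ Finset.Icc 1 ℓ, (k : ℝ) ^ (2 * (α - 1)) ≤ Y ^ 2) =>
    PerturbedOperator.localization hα hα1 hκ φ hφ hTφ hT hgap hB hTB hBφ hc hN hℓ hY hYc
  have hev := PerturbedOperator.eventually_isLargeEnough hα hα1 hκ hc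
  have hcover : ∀ (ℓ : ℕ+) (Y : ℝ), PerturbedOperator.outside α κ t ℓ Y ⊆
      PerturbedOperator.resolventSet (T + B) → ∀ w ∈ PerturbedOperator.opSpectrum (T + B),
      w ∈ PerturbedOperator.openBox (min 0 (t 1) - Y) (PerturbedOperator.rightEnd α κ t ℓ) Y ∨
      ∃ j : Set.Ioi ℓ, w ∈ PerturbedOperator.openBox (PerturbedOperator.leftEnd α κ t j)
        (PerturbedOperator.rightEnd α κ t j) (PerturbedOperator.halfHeight α κ j) := by
    intro ℓ Y hout w hw
    by_contra! h
    exact PerturbedOperator.mem_resolventSet_iff.1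
      (hout ⟨h.1, fun j hj => h.2 ⟨j, hj⟩⟩) hw
  have hlr := fun j => ((PerturbedOperator.leftEnd_lt (α := α) (t := t) hκ j).trans
    (PerturbedOperator.lt_rightEnd (α := α) hκ j)).le
  have hsimple : PerturbedOperator.HasDiscreteSpectrum (T + B) ∧
      PerturbedOperator.HasEventuallySimpleSpectrum (T + B) := by
    obtain ⟨N, hN⟩ := hev.exists
    obtain ⟨ℓ, hℓ⟩ := PerturbedOperator.exists_isGreatest_block hα1 N
    -- Discreteness needs just one admissible choice of N, ℓ and Y. Here Y = W + 1 works because (W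
    -- + 1)² ≥ W.
    set W := 4 * (⨆ k, |c k|) ^ 2 * ∑ k ∈ Finset.Icc 1 ℓ, (k : ℝ) ^ (2 * (α - 1)) with hW
    have hW0 : 0 ≤ W := by positivity
    have hY : 0 < W + 1 := by positivity
    obtain ⟨hout, hbig, hsmall⟩ := hloc N hN ℓ hℓ (W + 1) hY (by rw [← hW]; nlinarith)
    have hmem := PerturbedOperator.mem_openBox_big (Y := W + 1) hκ hgap hY (le_refl ℓ)
    exact PerturbedOperator.discrete_and_simple_of_boxes (ι := Set.Ioi ℓ)
      (hmem.1.trans hmem.2.1).le hY.le (fun j => hlr j)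
      (fun j => (PerturbedOperator.halfHeight_pos hκ j).le) (hcover ℓ _ hout)
      ((PerturbedOperator.frontier_bigBox_subset hκ hgap).trans hout)
      (fun j => (PerturbedOperator.frontier_smallBox_subset hκ hgap j.2).trans hout)
      hbig (fun j => hsmall j j.2)
  refine ⟨hsimple.1, hsimple.2, hev, fun N hN ℓ hℓ Y hY hYc => ?_⟩
  obtain ⟨hout, hbig, hsmall⟩ := hloc N hN ℓ hℓ Y hY hYc
  have hdisj : ∀ {A : H →ₗ.[ℂ] H} {S : Set ℂ}, S ⊆ PerturbedOperator.resolventSet A →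
      Disjoint S (PerturbedOperator.opSpectrum A) := fun hS =>
    Set.disjoint_left.2 fun z hz => PerturbedOperator.mem_resolventSet_iff.1 (hS hz)
  have hT1 := PerturbedOperator.opDim_smallProjection hκ φ hφ hTφ hT hgap
  refine ⟨fun w hw => ?_, ⟨?_, fun j hj => ?_, fun j => ?_⟩, ?_, fun j hj => ?_⟩
  · rcases hcover ℓ Y hout w hw with h | ⟨j, h⟩
    · exact Or.inl (PerturbedOperator.openBox_subset_box _ _ _ h)
    · exact Or.inr (Set.mem_biUnion j.2 (PerturbedOperator.openBox_subset_box _ _ _ h))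
  · exact hdisj ((PerturbedOperator.frontier_bigBox_subset hκ hgap).trans hout)
  · exact hdisj ((PerturbedOperator.frontier_smallBox_subset hκ hgap hj).trans hout)
  · exact hdisj (PerturbedOperator.frontier_smallBox_subset_resolventSet hκ hT hgap j)
  · rw [hbig, Finset.sum_congr rfl fun j _ => hT1 j]
    simp
  · exact ⟨(hsmall j hj).trans (hT1 j).symm, hT1 j⟩
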